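/- Let $n\ge 1$ and let $\Omega\subset\mathbb{R}^n$ be a bounded Lipschitz domain. Let $A\in C^2(\overline\Omega;\mathbb{R}^{n\times n})$ and $b\in C^2(\overline\Omega\times\mathbb{R}\times\mathbb{R}^n)$, and suppose that there is $\lambda>0$ such that for every $x\in\Omega$ the matrix $A(x)$ is symmetric and $\sum_{i,j}A_{ij}(x)\zeta_i\zeta_j\ge\lambda|\zeta|^2$ for all $\zeta\in\mathbb{R}^n$. Put $$S(u)=A:D^2u+b(x,u,Du),\qquad E_\infty(u)=\operatorname*{ess\,sup}_{\Omega}|S(u)|,$$ where $A:D^2u=\sum_{i,j}A_{ij}\,\partial_i\partial_ju$ and the derivatives are weak derivatives. Let $$\mathcal{W}^{2,\infty}(\Omega)=\bigcap_{1<q<\infty}\{u\in W^{2,q}(\Omega): A:D^2u\in L^\infty(\Omega)\},\qquad \mathcal{W}^{2,\infty}_0(\Omega)=\mathcal{W}^{2,\infty}(\Omega)\cap W^{2,2}_0(\Omega),$$ where $W^{2,p}_0(\Omega)$ denotes the closure of $C_0^\infty(\Omega)$ in $W^{2,p}(\Omega)$. Suppose that $S$ is admissible, i.e. there exists $p_0>1$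 such that for every $p\in[p_0,\infty)$, every $u_0\in\mathcal{W}^{2,\infty}(\Omega)$ and every $\Lambda>0$ there is $C>0$ such that every $u\in u_0+W^{2,p}_0(\Omega)$ with $\|S(u)\|_{L^p(\Omega)}\le\Lambda$ satisfies $\|u\|_{W^{2,p}(\Omega)}\le C$. Then for every $u_0\in\mathcal{W}^{2,\infty}(\Omega)$ the functional $E_\infty$ attains its minimum in $u_0+\mathcal{W}^{2,\infty}_0(\Omega)$, and the minimum is finite: there is $u\in u_0+\mathcal{W}^{2,\infty}_0(\Omega)$ with $E_\infty(u)<\infty$ and $E_\infty(u)\le E_\infty(v)$ for all $v\in u_0+\mathcal{W}^{2,\infty}_0(\Omega)$. -/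

import Mathlib

open MeasureTheory Set
open scoped NNReal ENNReal ContDiff

namespace SupremalSobolev

/-- A bounded Lipschitz domain in `ℝⁿ`: a bounded, open, connected, nonempty set which near
each boundary point is, in suitable orthonormal coordinates, the part of a ball strictly above the
graph of a Lipschitz function. Here `e` is the unit vector in the vertical direction, and
`y - ⟪e, y⟫ e` is the horizontal component of `y`. -/
structure IsBoundedLipschitzDomain {n : ℕ} (Ω : Set (EuclideanSpace ℝ (Fin n))) : Prop where
  isOpen : IsOpen Ω
  isConnected : IsConnected Ω
  isBounded : Bornology.IsBounded Ω
  lipschitz_boundary : ∀ x ∈ frontier Ω, ∃ r : ℝ, 0 < r ∧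
    ∃ e : EuclideanSpace ℝ (Fin n), ‖e‖ = 1 ∧
    ∃ (K : ℝ≥0) (γ : EuclideanSpace ℝ (Fin n) → ℝ), LipschitzWith K γ ∧
      ∀ y ∈ Metric.ball x r, (y ∈ Ω ↔ γ (y - (inner ℝ e y) • e) < inner ℝ e y)

/-- Smooth functions with compact support in `Ω`. -/
structure IsTestFunction {n : ℕ} (Ω : Set (EuclideanSpace ℝ (Fin n)))
    (φ : EuclideanSpace ℝ (Fin n) → ℝ) : Prop where
  contDiff : ContDiff ℝ ∞ φ
  hasCompactSupport : HasCompactSupport φ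
  tsupport_subset : tsupport φ ⊆ Ω

/-- The classical `i`-th partial derivative. -/
noncomputable def classicalPartial {n : ℕ} (i : Fin n) (φ : EuclideanSpace ℝ (Fin n) → ℝ) :
    EuclideanSpace ℝ (Fin n) → ℝ :=
  fun x => fderiv ℝ φ x (EuclideanSpace.single i 1)

/-- `g` is a weak `i`-th partial derivative of `u` in `Ω`. -/
structure HasWeakPartial {n : ℕ} (Ω : Set (EuclideanSpace ℝ (Fin n))) (i : Fin n)
    (u g : EuclideanSpace ℝ (Fin n) → ℝ) : Prop where
  locallyIntegrableOn : LocallyIntegrableOn u Ω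
  locallyIntegrableOn_deriv : LocallyIntegrableOn g Ω
  integral_eq : ∀ φ, IsTestFunction Ω φ →
    ∫ x in Ω, u x * classicalPartial i φ x = - ∫ x in Ω, g x * φ x

/-- Weak derivatives in an open set are unique almost everywhere. -/
theorem HasWeakPartial.ae_eq {n : ℕ} {Ω : Set (EuclideanSpace ℝ (Fin n))} (hΩ : IsOpen Ω)
    {i : Fin n} {u g h : EuclideanSpace ℝ (Fin n) → ℝ}
    (hg : HasWeakPartial Ω i u g) (hh : HasWeakPartial Ω i u h) :
    g =ᵐ[volume.restrict Ω] h := by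
  have key : ∀ᵐ x ∂(volume : Measure (EuclideanSpace ℝ (Fin n))), x ∈ Ω → (g - h) x = 0 := by
    refine hΩ.ae_eq_zero_of_integral_contDiff_smul_eq_zero
      (hg.locallyIntegrableOn_deriv.sub hh.locallyIntegrableOn_deriv) ?_
    intro φ hφ hc hs
    have ht : IsTestFunction Ω φ := ⟨hφ, hc, hs⟩
    have int : ∀ f : EuclideanSpace ℝ (Fin n) → ℝ, LocallyIntegrableOn f Ω →
        Integrable (fun x => f x * φ x) := by
      intro f hf
      have h1 : IntegrableOn f (tsupport φ) := hf.integrableOn_compact_subset hs hc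
      have h2 : IntegrableOn (fun x => f x * φ x) (tsupport φ) :=
        h1.mul_continuousOn hφ.continuous.continuousOn hc
      refine (integrableOn_iff_integrable_of_support_subset ?_).1 h2
      intro x hx
      exact subset_tsupport φ (right_ne_zero_of_mul hx)
    have ext : ∀ f : EuclideanSpace ℝ (Fin n) → ℝ,
        ∫ x in Ω, f x * φ x = ∫ x, f x * φ x := by
      intro f
      refine setIntegral_eq_integral_of_forall_compl_eq_zero ?_
      intro x hx
      rw [image_eq_zero_of_notMem_tsupport (fun hx' => hx (hs hx')), mul_zero]
    have e1 := hg.integral_eq φ ht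
    have e2 := hh.integral_eq φ ht
    rw [ext] at e1 e2
    have e3 : ∫ x, g x * φ x = ∫ x, h x * φ x := by linarith
    calc ∫ x, φ x • (g - h) x = ∫ x, (g x * φ x - h x * φ x) := by
          congr 1; ext x; simp only [Pi.sub_apply, smul_eq_mul]; ring
      _ = 0 := by
          rw [integral_sub (int g hg.locallyIntegrableOn_deriv)
            (int h hh.locallyIntegrableOn_deriv), e3, sub_self]
  rw [Filter.EventuallyEq, ae_restrict_iff' hΩ.measurableSet]
  filter_upwards [key] with x hx hxΩ
  exact sub_eq_zero.1 (hx hxΩ)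

open Classical in
/-- The weak `i`-th partial derivative of `u` in `Ω` (a representative; zero if there is none). -/
noncomputable def weakPartial {n : ℕ} (Ω : Set (EuclideanSpace ℝ (Fin n))) (i : Fin n)
    (u : EuclideanSpace ℝ (Fin n) → ℝ) : EuclideanSpace ℝ (Fin n) → ℝ :=
  if h : ∃ g, HasWeakPartial Ω i u g then h.choose else 0

theorem HasWeakPartial.weakPartial {n : ℕ} {Ω : Set (EuclideanSpace ℝ (Fin n))}
    {i : Fin n} {u g : EuclideanSpace ℝ (Fin n) → ℝ} (hg : HasWeakPartial Ω i u g) :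
    HasWeakPartial Ω i u (SupremalSobolev.weakPartial Ω i u) := by
  have h : ∃ g, HasWeakPartial Ω i u g := ⟨g, hg⟩
  rw [SupremalSobolev.weakPartial, dif_pos h]
  exact h.choose_spec

/-- The weak gradient `Du`. -/
noncomputable def weakGrad {n : ℕ} (Ω : Set (EuclideanSpace ℝ (Fin n)))
    (u : EuclideanSpace ℝ (Fin n) → ℝ) (x : EuclideanSpace ℝ (Fin n)) :
    EuclideanSpace ℝ (Fin n) :=
  WithLp.toLp 2 (fun i => weakPartial Ω i u x)

/-- The weak Hessian `D²u`. -/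
noncomputable def weakHess {n : ℕ} (Ω : Set (EuclideanSpace ℝ (Fin n)))
    (u : EuclideanSpace ℝ (Fin n) → ℝ) (x : EuclideanSpace ℝ (Fin n)) :
    Matrix (Fin n) (Fin n) ℝ :=
  Matrix.of (fun i j => weakPartial Ω j (weakPartial Ω i u) x)

/-- `u ∈ W^{1,p}(Ω)`. -/
def MemW1 {n : ℕ} (Ω : Set (EuclideanSpace ℝ (Fin n))) (p : ℝ≥0∞)
    (u : EuclideanSpace ℝ (Fin n) → ℝ) : Prop :=
  MemLp u p (volume.restrict Ω) ∧
    ∀ i, ∃ g, HasWeakPartial Ω i u g ∧ MemLp g p (volume.restrict Ω)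

/-- `u ∈ W^{2,p}(Ω)`. -/
def MemW2 {n : ℕ} (Ω : Set (EuclideanSpace ℝ (Fin n))) (p : ℝ≥0∞)
    (u : EuclideanSpace ℝ (Fin n) → ℝ) : Prop :=
  MemLp u p (volume.restrict Ω) ∧ ∀ i, ∃ g, HasWeakPartial Ω i u g ∧ MemW1 Ω p g

/-- The norm of `W^{2,p}(Ω)` (meaningful for elements of that space). -/
noncomputable def normW2 {n : ℕ} (Ω : Set (EuclideanSpace ℝ (Fin n))) (p : ℝ≥0∞)
    (u : EuclideanSpace ℝ (Fin n) → ℝ) : ℝ≥0∞ :=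
  eLpNorm u p (volume.restrict Ω)
    + ∑ i, eLpNorm (fun x => weakGrad Ω u x i) p (volume.restrict Ω)
    + ∑ i, ∑ j, eLpNorm (fun x => weakHess Ω u x i j) p (volume.restrict Ω)

/-- `u ∈ W_0^{2,p}(Ω)`, the closure of the test functions in `W^{2,p}(Ω)`. -/
def MemW2Zero {n : ℕ} (Ω : Set (EuclideanSpace ℝ (Fin n))) (p : ℝ≥0∞)
    (u : EuclideanSpace ℝ (Fin n) → ℝ) : Prop :=
  MemW2 Ω p u ∧ ∀ ε : ℝ≥0∞, 0 < ε → ∃ φ, IsTestFunction Ω φ ∧ normW2 Ω p (u - φ) < ε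

/-- The function `A : D²u`, with the Frobenius inner product of matrices. -/
noncomputable def principalPart {n : ℕ} (Ω : Set (EuclideanSpace ℝ (Fin n)))
    (A : EuclideanSpace ℝ (Fin n) → Matrix (Fin n) (Fin n) ℝ)
    (u : EuclideanSpace ℝ (Fin n) → ℝ) (x : EuclideanSpace ℝ (Fin n)) : ℝ :=
  ∑ i, ∑ j, A x i j * weakHess Ω u x i j

/-- The semilinear operator `S(u) = A : D²u + b(x, u, Du)`. -/
noncomputable def semilinearOp {n : ℕ} (Ω : Set (EuclideanSpace ℝ (Fin n)))
    (A : EuclideanSpace ℝ (Fin n) → Matrix (Fin n) (Fin n) ℝ)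
    (b : EuclideanSpace ℝ (Fin n) × ℝ × EuclideanSpace ℝ (Fin n) → ℝ)
    (u : EuclideanSpace ℝ (Fin n) → ℝ) (x : EuclideanSpace ℝ (Fin n)) : ℝ :=
  principalPart Ω A u x + b (x, u x, weakGrad Ω u x)

/-- The functional `E_∞(u) = ess sup_Ω |S(u)|`, with values in `[0, ∞]`. -/
noncomputable def EInfty {n : ℕ} (Ω : Set (EuclideanSpace ℝ (Fin n)))
    (A : EuclideanSpace ℝ (Fin n) → Matrix (Fin n) (Fin n) ℝ)
    (b : EuclideanSpace ℝ (Fin n) × ℝ × EuclideanSpace ℝ (Fin n) → ℝ)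
    (u : EuclideanSpace ℝ (Fin n) → ℝ) : ℝ≥0∞ :=
  essSup (fun x => ‖semilinearOp Ω A b u x‖ₑ) (volume.restrict Ω)

/-- `𝒲^{2,∞}(Ω)`: all `u` in `W^{2,q}(Ω)` for every `1 < q < ∞` with `A : D²u ∈ L^∞(Ω)`. -/
def MemCalW {n : ℕ} (Ω : Set (EuclideanSpace ℝ (Fin n)))
    (A : EuclideanSpace ℝ (Fin n) → Matrix (Fin n) (Fin n) ℝ)
    (u : EuclideanSpace ℝ (Fin n) → ℝ) : Prop :=
  (∀ q : ℝ≥0, 1 < q → MemW2 Ω q u) ∧ MemLp (principalPart Ω A u) ∞ (volume.restrict Ω)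

/-- `𝒲_0^{2,∞}(Ω) = 𝒲^{2,∞}(Ω) ∩ W_0^{2,2}(Ω)`. -/
def MemCalWZero {n : ℕ} (Ω : Set (EuclideanSpace ℝ (Fin n)))
    (A : EuclideanSpace ℝ (Fin n) → Matrix (Fin n) (Fin n) ℝ)
    (u : EuclideanSpace ℝ (Fin n) → ℝ) : Prop :=
  MemCalW Ω A u ∧ MemW2Zero Ω 2 u

/-- Admissibility of `S`: there is `p₀ > 1` such that for all finite `p ≥ p₀`, all
`u₀ ∈ 𝒲^{2,∞}(Ω)` and `Λ > 0`, the functions `u ∈ u₀ + W_0^{2,p}(Ω)` with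
`‖S(u)‖_{L^p} ≤ Λ` are bounded in `W^{2,p}(Ω)`. -/
def IsAdmissible {n : ℕ} (Ω : Set (EuclideanSpace ℝ (Fin n)))
    (A : EuclideanSpace ℝ (Fin n) → Matrix (Fin n) (Fin n) ℝ)
    (b : EuclideanSpace ℝ (Fin n) × ℝ × EuclideanSpace ℝ (Fin n) → ℝ) : Prop :=
  ∃ p₀ : ℝ≥0, 1 < p₀ ∧ ∀ p : ℝ≥0, p₀ ≤ p →
    ∀ u₀, MemCalW Ω A u₀ → ∀ Λ : ℝ≥0, 0 < Λ →
      ∃ C : ℝ≥0, 0 < C ∧ ∀ u, MemW2Zero Ω p (u - u₀) →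
        eLpNorm (semilinearOp Ω A b u) p (volume.restrict Ω) ≤ Λ → normW2 Ω p u ≤ C

end SupremalSobolev

/-! The proof is the direct method, with convex combinations taking the place of weak convergence of
the second derivatives. The infimum `m` of the energy is finite: by Morrey's embedding a function in
`W^{2,p}` with `p > n` has bounded values and gradient, so `b(x, u₀, Du₀)` is bounded, and `A :
D²u₀` is bounded by assumption. Along a minimizing sequence `v k` the functions `S(v k)` are bounded
in every `L^p`, and admissibility bounds `v k` in `W^{2,p}` for all large `p`
(`IsAdmissible.exists_bound`).

Admissibility asks for `v k - u₀ ∈ W_0^{2,p}`, whereas the class only provides `W_0^{2,2} ∩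
W^{2,p}`. On a Lipschitz domain the latter is contained in the former (`MemW2Zero.of_memW2`): extend
by zero, localize with a partition of unity, shift along an interior cone into `Ω`, and mollify.

Compactness (`exists_limit_jet`) has two halves. Values and gradients converge almost everywhere
along a subsequence, by Morrey's Hölder estimate and Arzelà–Ascoli applied to approximating test
functions. The second derivatives are only bounded, but in the Hilbert space `L²` suitable convex
combinations of tails converge strongly (`exists_tailWeight_tendsto`).

This suffices because `S` is linear in `D²u`. Averaging `S(v j)` over the tail `j ≥ k` gives a
function bounded by `m + 1/(k+1)`; its principal part converges to `A : D²u`, and the average of the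
lower order terms converges to `b(x, u, Du)`, since those terms converge pointwise. Hence `|S(u)| ≤
m` almost everywhere. Then `A : D²u = S(u) - b(x, u, Du)` is bounded, so `u` lies in the admissible
class and attains the infimum. -/

namespace SupremalSobolev

/-- Euclidean space of dimension `n`. -/
abbrev Euc (n : ℕ) : Type := EuclideanSpace ℝ (Fin n)

/-! ### Calculus of weak derivatives: linearity, product rule, limits. -/

section WeakDerivatives

variable {n : ℕ} {Ω : Set (Euc n)}

theorem classicalPartial_eq (i : Fin n) (φ : Euc n → ℝ) (x : Euc n) :
    classicalPartial i φ x = fderiv ℝ φ x (EuclideanSpace.single i 1) := rfl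

theorem continuous_classicalPartial {φ : Euc n → ℝ} (hφ : ContDiff ℝ 1 φ) (i : Fin n) :
    Continuous (classicalPartial i φ) :=
  (hφ.continuous_fderiv one_ne_zero).clm_apply continuous_const

theorem contDiff_classicalPartial {φ : Euc n → ℝ} (hφ : ContDiff ℝ ∞ φ) (i : Fin n) :
    ContDiff ℝ ∞ (classicalPartial i φ) :=
  (hφ.fderiv_right (m := ∞) (by simp)).clm_apply contDiff_const

theorem tsupport_classicalPartial_subset (φ : Euc n → ℝ) (i : Fin n) :
    tsupport (classicalPartial i φ) ⊆ tsupport φ := by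
  refine (closure_mono ?_).trans (tsupport_fderiv_subset ℝ (f := φ))
  intro x hx
  simp only [Function.mem_support, classicalPartial_eq] at hx ⊢
  intro h
  exact hx (by rw [h]; rfl)

theorem IsTestFunction.classicalPartial {φ : Euc n → ℝ} (hφ : IsTestFunction Ω φ) (i : Fin n) :
    IsTestFunction Ω (classicalPartial i φ) :=
  ⟨contDiff_classicalPartial hφ.contDiff i,
    hφ.hasCompactSupport.of_isClosed_subset (isClosed_tsupport _)
      (tsupport_classicalPartial_subset φ i),
    (tsupport_classicalPartial_subset φ i).trans hφ.tsupport_subset⟩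

theorem IsTestFunction.add {φ ψ : Euc n → ℝ} (hφ : IsTestFunction Ω φ)
    (hψ : IsTestFunction Ω ψ) : IsTestFunction Ω (φ + ψ) :=
  ⟨hφ.contDiff.add hψ.contDiff, hφ.hasCompactSupport.add hψ.hasCompactSupport,
    (tsupport_add φ ψ).trans (union_subset hφ.tsupport_subset hψ.tsupport_subset)⟩

theorem IsTestFunction.const_smul {φ : Euc n → ℝ} (hφ : IsTestFunction Ω φ) (c : ℝ) :
    IsTestFunction Ω (c • φ) :=
  ⟨hφ.contDiff.const_smul c, hφ.hasCompactSupport.smul_left (f := fun _ => c),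
    (tsupport_smul_subset_right (fun _ => c) φ).trans hφ.tsupport_subset⟩

theorem isTestFunction_zero : IsTestFunction Ω (0 : Euc n → ℝ) :=
  ⟨contDiff_const, HasCompactSupport.zero, by simp⟩

theorem isTestFunction_sum {ι : Type*} (s : Finset ι) {φ : ι → Euc n → ℝ}
    (h : ∀ i ∈ s, IsTestFunction Ω (φ i)) : IsTestFunction Ω (∑ i ∈ s, φ i) := by
  classical
  induction s using Finset.induction_on with
  | empty => simpa using isTestFunction_zero
  | insert a s ha ih =>
    rw [Finset.sum_insert ha]
    exact (h a (by simp)).add (ih fun i hi => h i (by simp [hi]))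

theorem integrable_mul_of_tsupport_subset {f ψ : Euc n → ℝ} (hf : LocallyIntegrableOn f Ω)
    (hψ : Continuous ψ) (hc : HasCompactSupport ψ) (hs : tsupport ψ ⊆ Ω) :
    Integrable (fun x => f x * ψ x) := by
  have h1 : IntegrableOn f (tsupport ψ) := hf.integrableOn_compact_subset hs hc
  have h2 : IntegrableOn (fun x => f x * ψ x) (tsupport ψ) :=
    h1.mul_continuousOn hψ.continuousOn hc
  refine (integrableOn_iff_integrable_of_support_subset ?_).1 h2
  intro x hx
  exact subset_tsupport ψ (right_ne_zero_of_mul hx)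

theorem IsTestFunction.integrable_mul {f φ : Euc n → ℝ} (hφ : IsTestFunction Ω φ)
    (hf : LocallyIntegrableOn f Ω) : Integrable (fun x => f x * φ x) :=
  integrable_mul_of_tsupport_subset hf hφ.contDiff.continuous hφ.hasCompactSupport
    hφ.tsupport_subset

theorem IsTestFunction.setIntegral_mul {φ : Euc n → ℝ} (hφ : IsTestFunction Ω φ)
    (f : Euc n → ℝ) : ∫ x in Ω, f x * φ x = ∫ x, f x * φ x := by
  refine setIntegral_eq_integral_of_forall_compl_eq_zero ?_
  intro x hx
  rw [image_eq_zero_of_notMem_tsupport (fun hx' => hx (hφ.tsupport_subset hx')), mul_zero]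

theorem HasWeakPartial.add {i : Fin n} {u v g h : Euc n → ℝ} (hu : HasWeakPartial Ω i u g)
    (hv : HasWeakPartial Ω i v h) : HasWeakPartial Ω i (u + v) (g + h) := by
  refine ⟨hu.1.add hv.1, hu.2.add hv.2, fun φ hφ => ?_⟩
  have hφ' := hφ.classicalPartial i
  simp only [Pi.add_apply, add_mul]
  rw [integral_add (hφ'.integrable_mul hu.1).integrableOn (hφ'.integrable_mul hv.1).integrableOn,
    integral_add (hφ.integrable_mul hu.2).integrableOn (hφ.integrable_mul hv.2).integrableOn,
    hu.3 φ hφ, hv.3 φ hφ]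
  ring

theorem HasWeakPartial.const_smul {i : Fin n} {u g : Euc n → ℝ} (hu : HasWeakPartial Ω i u g)
    (c : ℝ) : HasWeakPartial Ω i (c • u) (c • g) := by
  refine ⟨hu.1.smul c, hu.2.smul c, fun φ hφ => ?_⟩
  simp only [Pi.smul_apply, smul_eq_mul, mul_assoc]
  rw [integral_const_mul, integral_const_mul, hu.3 φ hφ]
  ring

theorem HasWeakPartial.congr (hΩ : IsOpen Ω) {i : Fin n} {u v g h : Euc n → ℝ}
    (hu : HasWeakPartial Ω i u g)
    (huv : u =ᵐ[volume.restrict Ω] v) (hgh : g =ᵐ[volume.restrict Ω] h) :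
    HasWeakPartial Ω i v h := by
  have key : ∀ {f f' : Euc n → ℝ}, f =ᵐ[volume.restrict Ω] f' → LocallyIntegrableOn f Ω →
      LocallyIntegrableOn f' Ω := by
    intro f f' hff hf
    rw [locallyIntegrableOn_iff hΩ.isLocallyClosed] at hf ⊢
    intro k hk hkc
    exact (hf k hk hkc).congr (ae_mono (Measure.restrict_mono hk le_rfl) hff)
  refine ⟨key huv hu.1, key hgh hu.2, fun φ hφ => ?_⟩
  rw [integral_congr_ae (g := fun x => u x * SupremalSobolev.classicalPartial i φ x)
    (by filter_upwards [huv] with x hx; rw [hx]), hu.3 φ hφ]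
  congr 1
  exact integral_congr_ae (by filter_upwards [hgh] with x hx; rw [hx])

theorem hasWeakPartial_of_contDiff {i : Fin n} {u : Euc n → ℝ} (hu : ContDiff ℝ 1 u) :
    HasWeakPartial Ω i u (classicalPartial i u) := by
  have hc := continuous_classicalPartial hu i
  have L1 := hu.continuous.locallyIntegrable (μ := volume)
  have L2 := hc.locallyIntegrable (μ := volume)
  refine ⟨L1.locallyIntegrableOn _, L2.locallyIntegrableOn _, fun φ hφ => ?_⟩
  have hφ' := hφ.classicalPartial i
  rw [hφ'.setIntegral_mul, hφ.setIntegral_mul]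
  exact integral_mul_fderiv_eq_neg_fderiv_mul_of_integrable
    (hφ.integrable_mul (L2.locallyIntegrableOn _)) (hφ'.integrable_mul (L1.locallyIntegrableOn _))
    (hφ.integrable_mul (L1.locallyIntegrableOn _))
    (fun x _ => hu.differentiable one_ne_zero x)
    (fun x _ => hφ.contDiff.differentiable (by simp) x)

/-- The weak identity for `u` is tested with `η * φ`; the product rule for this test function yields
the extra term with the derivative of `η`. -/
theorem HasWeakPartial.mul_contDiff {i : Fin n} {u g η : Euc n → ℝ} (hΩ : IsOpen Ω)
    (hu : HasWeakPartial Ω i u g) (hη : ContDiff ℝ ∞ η) :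
    HasWeakPartial Ω i (η * u) (classicalPartial i η * u + η * g) := by
  have key : ∀ {f a : Euc n → ℝ}, Continuous a → LocallyIntegrableOn f Ω →
      LocallyIntegrableOn (a * f) Ω := by
    intro f a ha hf
    exact hf.continuousOn_mul ha.continuousOn hΩ.isLocallyClosed
  have hc' := contDiff_classicalPartial hη i
  have l1 := key hη.continuous hu.1
  have l2 := key hc'.continuous hu.1
  have l3 := key hη.continuous hu.2
  refine ⟨l1, l2.add l3, fun φ hφ => ?_⟩
  have ht : ∀ {a : Euc n → ℝ}, ContDiff ℝ ∞ a → IsTestFunction Ω (a * φ) := fun {a} ha =>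
    ⟨ha.mul hφ.contDiff, hφ.hasCompactSupport.mul_left,
      (tsupport_mul_subset_right).trans hφ.tsupport_subset⟩
  have h1 := hu.3 _ (ht hη)
  have hφ' := hφ.classicalPartial i
  have hprod : ∀ x, SupremalSobolev.classicalPartial i (η * φ) x
      = η x * SupremalSobolev.classicalPartial i φ x
        + SupremalSobolev.classicalPartial i η x * φ x := by
    intro x
    simp only [classicalPartial_eq]
    rw [fderiv_mul (hη.differentiable (by simp) x) (hφ.contDiff.differentiable (by simp) x)]
    simp [mul_comm]
  have e1 : ∫ x in Ω, u x * SupremalSobolev.classicalPartial i (η * φ) x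
      = (∫ x in Ω, (η * u) x * SupremalSobolev.classicalPartial i φ x)
        + ∫ x in Ω, (SupremalSobolev.classicalPartial i η * u) x * φ x := by
    rw [← integral_add (hφ'.integrable_mul l1).integrableOn (hφ.integrable_mul l2).integrableOn]
    refine integral_congr_ae (Filter.Eventually.of_forall fun x => ?_)
    simp only [hprod, Pi.mul_apply]
    ring
  have e2 : ∫ x in Ω, g x * (η * φ) x = ∫ x in Ω, (η * g) x * φ x := by
    refine integral_congr_ae (Filter.Eventually.of_forall fun x => ?_)
    simp only [Pi.mul_apply]
    ring
  have e3 : ∫ x in Ω, (SupremalSobolev.classicalPartial i η * u + η * g) x * φ x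
      = (∫ x in Ω, (SupremalSobolev.classicalPartial i η * u) x * φ x)
        + ∫ x in Ω, (η * g) x * φ x := by
    rw [← integral_add (hφ.integrable_mul l2).integrableOn (hφ.integrable_mul l3).integrableOn]
    refine integral_congr_ae (Filter.Eventually.of_forall fun x => ?_)
    simp only [Pi.add_apply, add_mul]
  rw [e3]
  rw [e1, e2] at h1
  linarith

/-- Weak derivatives pass to limits in `L¹`. -/
theorem HasWeakPartial.of_tendsto {i : Fin n} {u g : Euc n → ℝ} {v h : ℕ → Euc n → ℝ}
    (hv : ∀ k, HasWeakPartial Ω i (v k) (h k))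
    (hu : LocallyIntegrableOn u Ω) (hg : LocallyIntegrableOn g Ω)
    (hvu : Filter.Tendsto (fun k => eLpNorm (v k - u) 1 (volume.restrict Ω)) Filter.atTop (nhds 0))
    (hhg : Filter.Tendsto (fun k => eLpNorm (h k - g) 1 (volume.restrict Ω)) Filter.atTop
      (nhds 0)) :
    HasWeakPartial Ω i u g := by
  refine ⟨hu, hg, fun φ hφ => ?_⟩
  have key : ∀ {f : Euc n → ℝ} {w : ℕ → Euc n → ℝ} {ψ : Euc n → ℝ}, IsTestFunction Ω ψ →
      LocallyIntegrableOn f Ω → (∀ k, LocallyIntegrableOn (w k) Ω) →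
      Filter.Tendsto (fun k => eLpNorm (w k - f) 1 (volume.restrict Ω)) Filter.atTop (nhds 0) →
      Filter.Tendsto (fun k => ∫ x in Ω, w k x * ψ x) Filter.atTop
        (nhds (∫ x in Ω, f x * ψ x)) := by
    intro f w ψ hψ hf hw hlim
    -- A test function is bounded, so `L¹` convergence survives multiplication by it and the
    -- pairings converge.
    obtain ⟨C, hC⟩ := hψ.contDiff.continuous.bounded_above_of_compact_support hψ.hasCompactSupport
    refine tendsto_integral_of_L1' _ (hψ.integrable_mul hf).aestronglyMeasurable.restrict
      (Filter.Eventually.of_forall fun k => (hψ.integrable_mul (hw k)).integrableOn) ?_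
    have hlim' : Filter.Tendsto
        (fun k => ENNReal.ofReal C * eLpNorm (w k - f) 1 (volume.restrict Ω))
        Filter.atTop (nhds 0) := by
      have := ENNReal.Tendsto.const_mul (a := ENNReal.ofReal C) hlim (Or.inr ENNReal.ofReal_ne_top)
      simpa using this
    refine tendsto_of_tendsto_of_tendsto_of_le_of_le tendsto_const_nhds hlim'
      (fun _ => zero_le) (fun k => ?_)
    refine eLpNorm_le_mul_eLpNorm_of_ae_le_mul (Filter.Eventually.of_forall fun x => ?_) 1
    have : ((fun x => w k x * ψ x) - fun x => f x * ψ x) x = ψ x * (w k - f) x := by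
      simp only [Pi.sub_apply]; ring
    rw [this, norm_mul]
    exact mul_le_mul_of_nonneg_right (hC x) (norm_nonneg _)
  have l1 := key (hφ.classicalPartial i) hu (fun k => (hv k).1) hvu
  have l2 := key hφ hg (fun k => (hv k).2) hhg
  refine tendsto_nhds_unique l1 ?_
  simp only [fun k => (hv k).3 φ hφ]
  exact l2.neg

end WeakDerivatives

/-! ### Jets: a function bundled with its weak derivatives up to order two. -/

section Jets

variable {n : ℕ} {Ω : Set (Euc n)}

/-- Indices of the partial derivatives of order at most two. -/
abbrev JetIndex (n : ℕ) : Type := Option (Fin n ⊕ (Fin n × Fin n))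

/-- A function together with candidates for its partial derivatives of order at most two. -/
abbrev Jet (n : ℕ) : Type := JetIndex n → Euc n → ℝ

/-- The components of a jet are the weak derivatives of its first entry. -/
structure IsWeakJet (Ω : Set (Euc n)) (J : Jet n) : Prop where
  first : ∀ i, HasWeakPartial Ω i (J none) (J (some (.inl i)))
  second : ∀ i j, HasWeakPartial Ω j (J (some (.inl i))) (J (some (.inr (i, j))))

/-- The sum of the `L^p` norms of the components of a jet. -/
noncomputable def jetNorm (Ω : Set (Euc n)) (p : ℝ≥0∞) (J : Jet n) : ℝ≥0∞ :=
  ∑ a, eLpNorm (J a) p (volume.restrict Ω)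

/-- The jet of the chosen weak derivatives of `u`. -/
noncomputable def weakJet (Ω : Set (Euc n)) (u : Euc n → ℝ) : Jet n
  | none => u
  | some (.inl i) => weakPartial Ω i u
  | some (.inr (i, j)) => weakPartial Ω j (weakPartial Ω i u)

/-- The jet of the classical derivatives of `u`. -/
noncomputable def classicalJet (u : Euc n → ℝ) : Jet n
  | none => u
  | some (.inl i) => classicalPartial i u
  | some (.inr (i, j)) => classicalPartial j (classicalPartial i u)

theorem normW2_eq_jetNorm (p : ℝ≥0∞) (u : Euc n → ℝ) :
    normW2 Ω p u = jetNorm Ω p (weakJet Ω u) := by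
  simp only [normW2, jetNorm, Fintype.sum_option, Fintype.sum_sum_type, Fintype.sum_prod_type,
    weakJet, weakGrad, weakHess, Matrix.of_apply, add_assoc]

theorem IsWeakJet.add {J K : Jet n} (hJ : IsWeakJet Ω J) (hK : IsWeakJet Ω K) :
    IsWeakJet Ω (J + K) :=
  ⟨fun i => (hJ.1 i).add (hK.1 i), fun i j => (hJ.2 i j).add (hK.2 i j)⟩

theorem IsWeakJet.const_smul {J : Jet n} (hJ : IsWeakJet Ω J) (c : ℝ) : IsWeakJet Ω (c • J) :=
  ⟨fun i => (hJ.1 i).const_smul c, fun i j => (hJ.2 i j).const_smul c⟩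

theorem IsWeakJet.sub {J K : Jet n} (hJ : IsWeakJet Ω J) (hK : IsWeakJet Ω K) :
    IsWeakJet Ω (J - K) := by
  have := hJ.add (hK.const_smul (-1))
  rwa [neg_one_smul, ← sub_eq_add_neg] at this

theorem isWeakJet_classicalJet {u : Euc n → ℝ} (hu : ContDiff ℝ ∞ u) :
    IsWeakJet Ω (classicalJet u) :=
  ⟨fun _ => hasWeakPartial_of_contDiff (hu.of_le (by simp)),
    fun i _ => hasWeakPartial_of_contDiff ((contDiff_classicalPartial hu i).of_le (by simp))⟩

theorem isWeakJet_zero : IsWeakJet Ω (0 : Jet n) := by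
  have := (isWeakJet_classicalJet (n := n) (Ω := Ω) (contDiff_const (c := (0 : ℝ)))).const_smul 0
  rwa [zero_smul] at this

theorem isWeakJet_sum {ι : Type*} (s : Finset ι) {J : ι → Jet n}
    (h : ∀ i ∈ s, IsWeakJet Ω (J i)) : IsWeakJet Ω (∑ i ∈ s, J i) := by
  classical
  induction s using Finset.induction_on with
  | empty => simpa using isWeakJet_zero
  | insert a s ha ih =>
    rw [Finset.sum_insert ha]
    exact (h a (by simp)).add (ih fun i hi => h i (by simp [hi]))

/-- Uniqueness of weak derivatives propagates from the function to the gradient and then to the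
Hessian. This allows the chosen representatives of `weakPartial` to be replaced by any convenient
jet, and jets to be compared through their zeroth entries alone. -/
theorem IsWeakJet.ae_eq (hΩ : IsOpen Ω) {J K : Jet n} (hJ : IsWeakJet Ω J) (hK : IsWeakJet Ω K)
    (h : J none =ᵐ[volume.restrict Ω] K none) (a : JetIndex n) :
    J a =ᵐ[volume.restrict Ω] K a := by
  have h1 : ∀ i, J (some (.inl i)) =ᵐ[volume.restrict Ω] K (some (.inl i)) := fun i =>
    ((hJ.1 i).congr hΩ h (Filter.EventuallyEq.refl _ _)).ae_eq hΩ (hK.1 i)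
  match a with
  | none => exact h
  | some (.inl i) => exact h1 i
  | some (.inr (i, j)) =>
    exact ((hJ.2 i j).congr hΩ (h1 i) (Filter.EventuallyEq.refl _ _)).ae_eq hΩ (hK.2 i j)

theorem IsWeakJet.weakJet (hΩ : IsOpen Ω) {J : Jet n} (hJ : IsWeakJet Ω J) :
    IsWeakJet Ω (weakJet Ω (J none)) := by
  have h1 : ∀ i, HasWeakPartial Ω i (J none) (weakPartial Ω i (J none)) := fun i =>
    (hJ.1 i).weakPartial
  exact ⟨h1, fun i j => ((hJ.2 i j).congr hΩ ((hJ.1 i).ae_eq hΩ (h1 i))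
    (Filter.EventuallyEq.refl _ _)).weakPartial⟩

theorem IsWeakJet.weakJet_ae_eq (hΩ : IsOpen Ω) {J : Jet n} (hJ : IsWeakJet Ω J)
    (a : JetIndex n) : SupremalSobolev.weakJet Ω (J none) a =ᵐ[volume.restrict Ω] J a :=
  (hJ.weakJet hΩ).ae_eq hΩ hJ (Filter.EventuallyEq.refl _ _) a

theorem MemW2.isWeakJet (hΩ : IsOpen Ω) {p : ℝ≥0∞} {u : Euc n → ℝ} (hu : MemW2 Ω p u) :
    IsWeakJet Ω (SupremalSobolev.weakJet Ω u) := by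
  choose g hg using hu.2
  choose h hh using fun i => (hg i).2.2
  let J : Jet n := fun
    | none => u
    | some (.inl i) => g i
    | some (.inr (i, j)) => h i j
  have hJ : IsWeakJet Ω J := ⟨fun i => (hg i).1, fun i j => (hh i j).1⟩
  exact hJ.weakJet hΩ

theorem MemW2.memLp (hΩ : IsOpen Ω) {p : ℝ≥0∞} {u : Euc n → ℝ} (hu : MemW2 Ω p u)
    {J : Jet n} (hJ : IsWeakJet Ω J) (h : J none = u) (a : JetIndex n) :
    MemLp (J a) p (volume.restrict Ω) := by
  choose g hg using hu.2
  choose h' hh using fun i => (hg i).2.2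
  let K : Jet n := fun
    | none => u
    | some (.inl i) => g i
    | some (.inr (i, j)) => h' i j
  have hK : IsWeakJet Ω K := ⟨fun i => (hg i).1, fun i j => (hh i j).1⟩
  have hae := hK.ae_eq hΩ hJ (by rw [h]) a
  refine (memLp_congr_ae hae).1 ?_
  match a with
  | none => exact hu.1
  | some (.inl i) => exact (hg i).2.1
  | some (.inr (i, j)) => exact (hh i j).2

theorem IsWeakJet.memW2 {p : ℝ≥0∞} {J : Jet n} (hJ : IsWeakJet Ω J)
    (h : ∀ a, MemLp (J a) p (volume.restrict Ω)) : MemW2 Ω p (J none) :=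
  ⟨h none, fun i => ⟨_, hJ.1 i, h _, fun j => ⟨_, hJ.2 i j, h _⟩⟩⟩

theorem IsWeakJet.normW2_eq (hΩ : IsOpen Ω) {J : Jet n} (hJ : IsWeakJet Ω J) (p : ℝ≥0∞) :
    normW2 Ω p (J none) = jetNorm Ω p J := by
  rw [normW2_eq_jetNorm]
  exact Finset.sum_congr rfl fun a _ => eLpNorm_congr_ae (hJ.weakJet_ae_eq hΩ a)

theorem eLpNorm_le_jetNorm (p : ℝ≥0∞) (J : Jet n) (a : JetIndex n) :
    eLpNorm (J a) p (volume.restrict Ω) ≤ jetNorm Ω p J :=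
  Finset.single_le_sum (f := fun a => eLpNorm (J a) p (volume.restrict Ω))
    (fun _ _ => zero_le) (Finset.mem_univ a)

end Jets


/-! ### Minkowski's inequality for averages. -/

section Averages

/-- Minkowski's inequality for averages: the `L^p` norm of an average of functions is at most the
supremum of their `L^p` norms. -/
theorem eLpNorm_integral_le_of_forall {X Z : Type*} [MeasurableSpace X] [MeasurableSpace Z]
    {μ : Measure X} [SFinite μ] {ν : Measure Z} [IsProbabilityMeasure ν] {F : X → Z → ℝ}
    (hF : AEStronglyMeasurable (Function.uncurry F) (μ.prod ν)) {p : ℝ≥0} (hp : 1 ≤ p)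
    {C : ℝ≥0∞} (hC : ∀ᵐ z ∂ν, eLpNorm (fun x => F x z) p μ ≤ C) :
    eLpNorm (fun x => ∫ z, F x z ∂ν) p μ ≤ C := by
  have hp0 : (p : ℝ≥0∞) ≠ 0 := by
    simpa using (zero_lt_one.trans_le hp).ne'
  have hp0' : (0 : ℝ) < p := zero_lt_one.trans_le (by exact_mod_cast hp)
  have hpt : (p : ℝ≥0∞) ≠ ⊤ := ENNReal.coe_ne_top
  have hpr : (p : ℝ≥0∞).toReal = (p : ℝ) := rfl
  rw [eLpNorm_eq_lintegral_rpow_enorm_toReal hp0 hpt, hpr, one_div,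
    ENNReal.rpow_inv_le_iff hp0']
  -- Jensen's inequality at fixed `x`, in the form that `L¹` norms are at most `L^p` norms over a
  -- probability measure; Tonelli then swaps the two integrals.
  have h1 : ∀ᵐ x ∂μ, ‖∫ z, F x z ∂ν‖ₑ ^ (p : ℝ) ≤ ∫⁻ z, ‖F x z‖ₑ ^ (p : ℝ) ∂ν := by
    filter_upwards [hF.prodMk_left] with x hx
    have h2 : eLpNorm (F x) 1 ν ≤ eLpNorm (F x) p ν :=
      eLpNorm_le_eLpNorm_of_exponent_le (by exact_mod_cast hp) hx
    rw [eLpNorm_one_eq_lintegral_enorm, eLpNorm_eq_lintegral_rpow_enorm_toReal hp0 hpt, hpr,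
      one_div, ENNReal.le_rpow_inv_iff hp0'] at h2
    exact (ENNReal.rpow_le_rpow (enorm_integral_le_lintegral_enorm _) hp0'.le).trans h2
  have hm : AEMeasurable (Function.uncurry fun x z => ‖F x z‖ₑ ^ (p : ℝ)) (μ.prod ν) :=
    hF.enorm.pow_const _
  calc ∫⁻ x, ‖∫ z, F x z ∂ν‖ₑ ^ (p : ℝ) ∂μ
      ≤ ∫⁻ x, ∫⁻ z, ‖F x z‖ₑ ^ (p : ℝ) ∂ν ∂μ := lintegral_mono_ae h1
    _ = ∫⁻ z, ∫⁻ x, ‖F x z‖ₑ ^ (p : ℝ) ∂μ ∂ν := lintegral_lintegral_swap hm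
    _ ≤ ∫⁻ _, C ^ (p : ℝ) ∂ν := by
        refine lintegral_mono_ae ?_
        filter_upwards [hC] with z hz
        rwa [eLpNorm_eq_lintegral_rpow_enorm_toReal hp0 hpt, hpr, one_div,
          ENNReal.rpow_inv_le_iff hp0'] at hz
    _ = C ^ (p : ℝ) := by simp

end Averages

/-! ### Mollification: commutation with weak derivatives and approximation in `L^p`. -/

section Mollification

variable {n : ℕ} {Ω : Set (Euc n)}

/-- Convolution of `f` with `ρ`. -/
noncomputable def mollify (ρ f : Euc n → ℝ) : Euc n → ℝ :=
  convolution ρ f (ContinuousLinearMap.lsmul ℝ ℝ) volume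

theorem mollify_eq_flip (ρ f : Euc n → ℝ) :
    mollify ρ f = convolution f ρ (ContinuousLinearMap.lsmul ℝ ℝ).flip volume :=
  (convolution_flip _).symm

theorem mollify_apply (ρ f : Euc n → ℝ) (x : Euc n) :
    mollify ρ f x = ∫ z, ρ z * f (x - z) := rfl

theorem mollify_apply' (ρ f : Euc n → ℝ) (x : Euc n) :
    mollify ρ f x = ∫ y, f y * ρ (x - y) := by
  rw [mollify_eq_flip]
  simp only [convolution_def, ContinuousLinearMap.flip_apply, ContinuousLinearMap.lsmul_apply,
    smul_eq_mul, mul_comm]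

theorem contDiff_mollify {ρ f : Euc n → ℝ} (hρ : ContDiff ℝ ∞ ρ) (hc : HasCompactSupport ρ)
    (hf : LocallyIntegrable f) : ContDiff ℝ ∞ (mollify ρ f) :=
  hc.contDiff_convolution_left _ hρ hf

theorem classicalPartial_mollify {ρ f : Euc n → ℝ} (hρ : ContDiff ℝ ∞ ρ)
    (hc : HasCompactSupport ρ) (hf : LocallyIntegrable f) (i : Fin n) (x : Euc n) :
    classicalPartial i (mollify ρ f) x = ∫ y, f y * classicalPartial i ρ (x - y) := by
  rw [classicalPartial_eq, mollify_eq_flip,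
    (hc.hasFDerivAt_convolution_right _ hf (hρ.of_le (by simp)) x).fderiv,
    convolution_precompR_apply _ hf (hc.fderiv ℝ) (hρ.continuous_fderiv (by simp)),
    convolution_def]
  simp only [ContinuousLinearMap.flip_apply, ContinuousLinearMap.lsmul_apply, smul_eq_mul]
  refine integral_congr_ae (Filter.Eventually.of_forall fun y => ?_)
  simp only [classicalPartial_eq]
  ring

theorem isTestFunction_reflect {ρ : Euc n → ℝ} (hρ : ContDiff ℝ ∞ ρ)
    (hc : HasCompactSupport ρ) {x : Euc n} (hx : ∀ z ∈ tsupport ρ, x - z ∈ Ω) :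
    IsTestFunction Ω (fun y => ρ (x - y)) := by
  have ht : tsupport (fun y => ρ (x - y)) ⊆ (fun z => x - z) '' tsupport ρ := by
    refine closure_minimal ?_ (hc.image (by fun_prop)).isClosed
    intro y hy
    exact ⟨x - y, subset_tsupport ρ hy, sub_sub_cancel x y⟩
  refine ⟨hρ.comp (by fun_prop), ?_, ht.trans ?_⟩
  · exact (hc.image (by fun_prop : Continuous fun z => x - z)).of_isClosed_subset
      (isClosed_tsupport _) ht
  · rintro _ ⟨z, hz, rfl⟩
    exact hx z hz

theorem classicalPartial_reflect {ρ : Euc n → ℝ} (hρ : ContDiff ℝ ∞ ρ) (x y : Euc n)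
    (i : Fin n) :
    classicalPartial i (fun y => ρ (x - y)) y = - classicalPartial i ρ (x - y) := by
  have h1 : HasFDerivAt ρ (fderiv ℝ ρ (x - y)) (x - y) :=
    (hρ.differentiable (by simp) _).hasFDerivAt
  have h2 : HasFDerivAt (fun y => x - y) (-ContinuousLinearMap.id ℝ (Euc n)) y :=
    (hasFDerivAt_id y).const_sub x
  have h3 := h1.comp y h2
  rw [classicalPartial_eq, classicalPartial_eq]
  have h4 : fderiv ℝ (fun y => ρ (x - y)) y = _ := h3.fderiv
  rw [h4]
  simp

theorem integral_indicator_mul (hΩ : MeasurableSet Ω) (f g : Euc n → ℝ) :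
    ∫ y, Ω.indicator f y * g y = ∫ y in Ω, f y * g y := by
  rw [← integral_indicator hΩ]
  refine integral_congr_ae (Filter.Eventually.of_forall fun y => ?_)
  by_cases hy : y ∈ Ω <;> simp [hy]

/-- The reflected kernel `y ↦ ρ (x - y)` is a test function for `Ω` once `x - tsupport ρ` lies in
`Ω`, so the derivative on the kernel can be moved to `u`. The sign from the reflection cancels the
sign in the weak identity. -/
theorem HasWeakPartial.classicalPartial_mollify {i : Fin n} {u g ρ : Euc n → ℝ} (hΩ : IsOpen Ω)
    (hu : HasWeakPartial Ω i u g) (hui : LocallyIntegrable (Ω.indicator u))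
    (hρ : ContDiff ℝ ∞ ρ) (hc : HasCompactSupport ρ) {x : Euc n}
    (hx : ∀ z ∈ tsupport ρ, x - z ∈ Ω) :
    classicalPartial i (mollify ρ (Ω.indicator u)) x = mollify ρ (Ω.indicator g) x := by
  rw [SupremalSobolev.classicalPartial_mollify hρ hc hui, mollify_apply',
    integral_indicator_mul hΩ.measurableSet, integral_indicator_mul hΩ.measurableSet]
  have h := hu.3 _ (isTestFunction_reflect hρ hc hx)
  simp only [classicalPartial_reflect hρ, mul_neg, integral_neg] at h
  linarith

/-- The probability measure with density a normed bump function. -/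
noncomputable def bumpMeasure {c : Euc n} (φ : ContDiffBump c) : Measure (Euc n) :=
  volume.withDensity fun z => ((φ.normed volume z).toNNReal : ℝ≥0∞)

theorem measurable_bump {c : Euc n} (φ : ContDiffBump c) :
    Measurable fun z => (φ.normed volume z).toNNReal :=
  (φ.continuous_normed (μ := volume)).measurable.real_toNNReal

theorem isProbabilityMeasure_bumpMeasure {c : Euc n} (φ : ContDiffBump c) :
    IsProbabilityMeasure (bumpMeasure φ) := by
  refine ⟨?_⟩
  rw [bumpMeasure, withDensity_apply _ MeasurableSet.univ, Measure.restrict_univ]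
  have h := ofReal_integral_eq_lintegral_ofReal (φ.integrable_normed (μ := volume))
    (Filter.Eventually.of_forall φ.nonneg_normed)
  rw [φ.integral_normed, ENNReal.ofReal_one] at h
  exact h.symm

theorem integral_bumpMeasure {c : Euc n} (φ : ContDiffBump c) (f : Euc n → ℝ) :
    ∫ z, f z ∂(bumpMeasure φ) = ∫ z, φ.normed volume z * f z := by
  rw [bumpMeasure, integral_withDensity_eq_integral_smul (measurable_bump φ)]
  refine integral_congr_ae (Filter.Eventually.of_forall fun z => ?_)
  simp only [NNReal.smul_def, Real.coe_toNNReal _ (φ.nonneg_normed z), smul_eq_mul]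

theorem bumpMeasure_absolutelyContinuous {c : Euc n} (φ : ContDiffBump c) :
    bumpMeasure φ ≪ volume := withDensity_absolutelyContinuous _ _

theorem ae_bumpMeasure_mem_ball {c : Euc n} (φ : ContDiffBump c) :
    ∀ᵐ z ∂(bumpMeasure φ), z ∈ Metric.ball c φ.rOut := by
  rw [bumpMeasure, ae_withDensity_iff (measurable_bump φ).coe_nnreal_ennreal]
  refine Filter.Eventually.of_forall fun z hz => ?_
  rw [← φ.support_normed_eq (μ := volume)]
  intro h
  simp [h] at hz

/-- Subtraction is quasi measure preserving for Lebesgue measure, and the bump measure is absolutely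
continuous, so an almost everywhere class may be composed with it. -/
theorem aestronglyMeasurable_comp_sub {c : Euc n} (φ : ContDiffBump c) {f : Euc n → ℝ}
    (hf : AEStronglyMeasurable f volume) :
    AEStronglyMeasurable (fun q : Euc n × Euc n => f (q.1 - q.2))
      (volume.prod (bumpMeasure φ)) := by
  have := isProbabilityMeasure_bumpMeasure φ
  have h1 : AEStronglyMeasurable (fun q : Euc n × Euc n => f (q.1 - q.2))
      (volume.prod volume) :=
    hf.comp_quasiMeasurePreserving (quasiMeasurePreserving_sub_of_right_invariant volume volume)
  exact h1.mono_ac (Measure.AbsolutelyContinuous.rfl.prod (bumpMeasure_absolutelyContinuous φ))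

theorem eLpNorm_translate {f : Euc n → ℝ} (hf : AEStronglyMeasurable f volume) (p : ℝ≥0∞)
    (z : Euc n) : eLpNorm (fun x => f (x - z)) p volume = eLpNorm f p volume :=
  eLpNorm_comp_measurePreserving hf (measurePreserving_sub_right volume z)

/-- Young's inequality for mollifiers. -/
theorem eLpNorm_mollify_le {c : Euc n} (φ : ContDiffBump c) {f : Euc n → ℝ}
    (hf : AEStronglyMeasurable f volume) {p : ℝ≥0} (hp : 1 ≤ p) :
    eLpNorm (mollify (φ.normed volume) f) p volume ≤ eLpNorm f p volume := by
  have := isProbabilityMeasure_bumpMeasure φ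
  have h : mollify (φ.normed volume) f = fun x => ∫ z, f (x - z) ∂(bumpMeasure φ) := by
    funext x
    rw [integral_bumpMeasure, mollify_apply]
  rw [h]
  exact eLpNorm_integral_le_of_forall (F := fun x z => f (x - z))
    (aestronglyMeasurable_comp_sub φ hf) hp
    (Filter.Eventually.of_forall fun z => (eLpNorm_translate hf p z).le)

/-- Continuity of translations in `L^p`. -/
theorem exists_forall_eLpNorm_translate_sub_le {f : Euc n → ℝ} {p : ℝ≥0} (hp : 1 ≤ p)
    (hf : MemLp f p volume) {ε : ℝ≥0∞} (hε : 0 < ε) :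
    ∃ δ > 0, ∀ z : Euc n, ‖z‖ < δ → eLpNorm (fun x => f (x - z) - f x) p volume ≤ ε := by
  have : Fact (1 ≤ (p : ℝ≥0∞)) := ⟨by exact_mod_cast hp⟩
  -- Translations depend continuously on the shift in the compact-open topology and preserve volume;
  -- composition with such a family is continuous in `L^p` for finite `p`.
  let G : Euc n → C(Euc n, Euc n) :=
    (ContinuousMap.mk (fun a : Euc n × Euc n => a.2 - a.1) (by fun_prop)).curry
  have hG : Continuous G := ContinuousMap.continuous _
  have hmp : ∀ z, MeasurePreserving (G z) volume volume :=
    fun z => measurePreserving_sub_right volume z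
  have hcont := (continuous_const (y := hf.toLp f)).compMeasurePreservingLp hG hmp
    ENNReal.coe_ne_top
  have h0 := EMetric.tendsto_nhds.1 (hcont.tendsto 0) ε hε
  obtain ⟨δ, hδ, h⟩ := Metric.eventually_nhds_iff.1 h0
  refine ⟨δ, hδ, fun z hz => ?_⟩
  have h1 := (h (y := z) (by simpa using hz)).le
  rw [Lp.edist_def] at h1
  refine le_trans (eLpNorm_congr_ae ?_).le h1
  have hc : ∀ z, (Lp.compMeasurePreserving (G z) (hmp z) (hf.toLp f) : Euc n → ℝ) =ᵐ[volume]
      fun x => f (x - z) := fun z =>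
    (Lp.coeFn_compMeasurePreserving _ (hmp z)).trans
      ((hmp z).quasiMeasurePreserving.ae_eq_comp hf.coeFn_toLp)
  filter_upwards [hc z, hc 0] with x h2 h3
  simp only [Pi.sub_apply]
  rw [h2, h3, sub_zero]

/-- Mollifiers supported close to the origin approximate in `L^p`. -/
theorem exists_forall_eLpNorm_mollify_sub_le {f : Euc n → ℝ} {p : ℝ≥0} (hp : 1 ≤ p)
    (hf : MemLp f p volume) {ε : ℝ≥0∞} (hε : 0 < ε) :
    ∃ δ > 0, ∀ (c : Euc n) (φ : ContDiffBump c), ‖c‖ + φ.rOut < δ →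
      eLpNorm (mollify (φ.normed volume) f - f) p volume ≤ ε := by
  obtain ⟨δ, hδ, h⟩ := exists_forall_eLpNorm_translate_sub_le hp hf hε
  refine ⟨δ, hδ, fun c φ hφ => ?_⟩
  have := isProbabilityMeasure_bumpMeasure φ
  have hloc : LocallyIntegrable f := hf.locallyIntegrable (by exact_mod_cast hp)
  -- The bump has mass one, so the error is an average of translation differences. Its centre need
  -- not be the origin: only the size of the shifts in its support matters, and an off-centre bump
  -- shifts and smooths at once.
  have heq : mollify (φ.normed volume) f - f
      = fun x => ∫ z, (f (x - z) - f x) ∂(bumpMeasure φ) := by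
    funext x
    have hint : Integrable (fun z => φ.normed volume z * f (x - z)) :=
      (φ.hasCompactSupport_normed.convolutionExists_left
        (ContinuousLinearMap.lsmul ℝ ℝ) φ.continuous_normed hloc) x
    rw [integral_bumpMeasure, Pi.sub_apply, mollify_apply]
    simp only [mul_sub]
    rw [integral_sub hint (φ.integrable_normed.mul_const _), integral_mul_const,
      φ.integral_normed, one_mul]
  rw [heq]
  refine eLpNorm_integral_le_of_forall (F := fun x z => f (x - z) - f x)
    ((aestronglyMeasurable_comp_sub φ hf.1).sub hf.1.comp_fst) hp ?_
  filter_upwards [ae_bumpMeasure_mem_ball φ] with z hz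
  refine h z (lt_of_le_of_lt ?_ hφ)
  have h1 : ‖z - c‖ < φ.rOut := by rwa [← dist_eq_norm]
  have h2 : ‖z‖ ≤ ‖c‖ + ‖z - c‖ := by simpa using norm_add_le c (z - c)
  linarith

open scoped Pointwise in
theorem tsupport_mollify_subset {ρ f : Euc n → ℝ} {K : Set (Euc n)}
    (hc : HasCompactSupport ρ) (hK : IsCompact K) (hf : ∀ x ∉ K, f x = 0) :
    tsupport (mollify ρ f) ⊆ K + tsupport ρ := by
  refine closure_minimal ?_ (hK.add hc).isClosed
  intro x hx
  obtain ⟨a, ha, b, hb, rfl⟩ := support_convolution_subset_swap (μ := volume) _ hx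
  refine ⟨a, ?_, b, subset_tsupport _ hb, rfl⟩
  by_contra h
  exact ha (hf a h)

end Mollification


/-! ### Interior cones of Lipschitz domains. -/

section Geometry

variable {n : ℕ} {Ω : Set (Euc n)}

/-- A Lipschitz domain has the local uniform interior cone property. -/
theorem IsBoundedLipschitzDomain.exists_cone (hΩ : IsBoundedLipschitzDomain Ω) {x₀ : Euc n}
    (hx₀ : x₀ ∈ closure Ω) :
    ∃ r > 0, ∃ e : Euc n, ∃ κ > 0, ‖e‖ ≤ 1 ∧ κ ≤ 1 ∧ ∀ x ∈ closure Ω, dist x x₀ < r →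
      ∀ s, 0 < s → s < r → ∀ h : Euc n, ‖h‖ ≤ κ * s → x + s • e + h ∈ Ω := by
  by_cases hx : x₀ ∈ Ω
  · obtain ⟨R, hR, hball⟩ := Metric.isOpen_iff.1 hΩ.isOpen x₀ hx
    -- At an interior point the axis `e = 0` will do: the points `x + h` stay in a ball inside `Ω`.
    refine ⟨R / 3, by positivity, 0, 1, one_pos, by simp, le_rfl, fun x _ hxr s _ hsr h hh =>
      hball ?_⟩
    rw [Metric.mem_ball, smul_zero, add_zero]
    have h1 : dist (x + h) x ≤ 1 * s := by simpa [dist_eq_norm] using hh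
    have h2 := dist_triangle (x + h) x x₀
    linarith
  · have hfr : x₀ ∈ frontier Ω := ⟨hx₀, fun h => hx (interior_subset h)⟩
    obtain ⟨r, hr, e, he, K, γ, hγ, hmem⟩ := hΩ.lipschitz_boundary x₀ hfr
    have hK : (0 : ℝ) ≤ K := K.2
    have hκ1 : (1 : ℝ) / (2 * K + 2) ≤ 1 := by
      rw [div_le_one (by positivity)]; linarith
    -- The step `h` moves the horizontal component by at most `2‖h‖`, hence the graph by at most
    -- `2K‖h‖`, while the height grows by at least `s - ‖h‖`. The bound `(2K + 2)‖h‖ ≤ s` therefore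
    -- gives a strict inequality. The radius `r / 4` keeps `x + s • e + h` in the ball of the graph
    -- description.
    refine ⟨r / 4, by positivity, e, 1 / (2 * K + 2), by positivity, he.le, hκ1,
      fun x hxc hxr s hs hsr h hh => ?_⟩
    have hhs : ‖h‖ ≤ s := hh.trans (by nlinarith)
    -- Points of the closure lie weakly above the graph, by continuity; the vertical step makes this
    -- strict.
    have hle : γ (x - (inner ℝ e x) • e) ≤ inner ℝ e x := by
      have hcl : IsClosed {y : Euc n | γ (y - (inner ℝ e y) • e) ≤ inner ℝ e y} :=
        isClosed_le (hγ.continuous.comp (by fun_prop)) (by fun_prop)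
      have hsub : Ω ∩ Metric.ball x₀ r ⊆ {y : Euc n | γ (y - (inner ℝ e y) • e) ≤ inner ℝ e y} :=
        fun y hy => ((hmem y hy.2).1 hy.1).le
      refine closure_minimal hsub hcl ?_
      rw [inter_comm]
      exact Metric.isOpen_ball.inter_closure ⟨by rw [Metric.mem_ball]; linarith, hxc⟩
    have hball : x + s • e + h ∈ Metric.ball x₀ r := by
      rw [Metric.mem_ball]
      have h1 : dist (x + s • e + h) x ≤ s + ‖h‖ := by
        rw [dist_eq_norm, show x + s • e + h - x = s • e + h by abel]
        refine (norm_add_le _ _).trans ?_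
        rw [norm_smul, he, mul_one, Real.norm_of_nonneg hs.le]
      have h2 := dist_triangle (x + s • e + h) x x₀
      linarith
    rw [hmem _ hball]
    have hee : inner ℝ e e = (1 : ℝ) := by rw [real_inner_self_eq_norm_sq, he]; norm_num
    have hin : inner ℝ e (x + s • e + h) = inner ℝ e x + s + inner ℝ e h := by
      rw [inner_add_right, inner_add_right, inner_smul_right, hee, mul_one]
    have hih : |inner ℝ e h| ≤ ‖h‖ := by
      have := abs_real_inner_le_norm e h
      rwa [he, one_mul] at this
    have hdist : dist (x + s • e + h - (inner ℝ e (x + s • e + h)) • e)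
        (x - (inner ℝ e x) • e) ≤ 2 * ‖h‖ := by
      rw [hin, dist_eq_norm, show x + s • e + h - (inner ℝ e x + s + inner ℝ e h) • e
        - (x - (inner ℝ e x) • e) = h - (inner ℝ e h) • e by module]
      refine (norm_sub_le _ _).trans ?_
      rw [norm_smul, he, mul_one, Real.norm_eq_abs]
      linarith
    have hlip := hγ.dist_le_mul (x + s • e + h - (inner ℝ e (x + s • e + h)) • e)
      (x - (inner ℝ e x) • e)
    have h3 := (le_abs_self _).trans ((Real.dist_eq _ _).symm.le.trans hlip)
    have h4 : (K : ℝ) * dist (x + s • e + h - (inner ℝ e (x + s • e + h)) • e)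
        (x - (inner ℝ e x) • e) ≤ K * (2 * ‖h‖) := mul_le_mul_of_nonneg_left hdist hK
    have h5 := (abs_le.1 hih).1
    have h6 : (2 * K + 2) * ‖h‖ ≤ s := by
      have := mul_le_mul_of_nonneg_left hh (by positivity : (0 : ℝ) ≤ 2 * K + 2)
      rwa [← mul_assoc, mul_one_div_cancel (by positivity), one_mul] at this
    refine lt_of_lt_of_eq ?_ hin.symm
    rcases (norm_nonneg h).eq_or_lt with h0 | h0 <;> nlinarith

end Geometry

/-! ### Zero boundary values: extension by zero and local approximation. -/

section ZeroBoundary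

variable {n : ℕ} {Ω : Set (Euc n)}

/-- The jet of a product, in terms of the jet of the second factor. -/
noncomputable def jetMul (η : Euc n → ℝ) (J : Jet n) : Jet n
  | none => η * J none
  | some (.inl i) => classicalPartial i η * J none + η * J (some (.inl i))
  | some (.inr (i, j)) =>
      (classicalPartial j (classicalPartial i η) * J none
          + classicalPartial i η * J (some (.inl j)))
        + (classicalPartial j η * J (some (.inl i)) + η * J (some (.inr (i, j))))

theorem IsWeakJet.jetMul (hΩ : IsOpen Ω) {J : Jet n} (hJ : IsWeakJet Ω J) {η : Euc n → ℝ}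
    (hη : ContDiff ℝ ∞ η) : IsWeakJet Ω (jetMul η J) :=
  ⟨fun i => (hJ.1 i).mul_contDiff hΩ hη, fun i j =>
    ((hJ.1 j).mul_contDiff hΩ (contDiff_classicalPartial hη i)).add
      ((hJ.2 i j).mul_contDiff hΩ hη)⟩

theorem memLp_mul_of_hasCompactSupport {μ : Measure (Euc n)} {η f : Euc n → ℝ} {p : ℝ≥0∞}
    (hη : Continuous η) (hc : HasCompactSupport η) (hf : MemLp f p μ) : MemLp (η * f) p μ := by
  obtain ⟨C, hC⟩ := hη.bounded_above_of_compact_support hc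
  refine hf.of_le_mul (c := C) (hη.aestronglyMeasurable.mul hf.1)
    (Filter.Eventually.of_forall fun x => ?_)
  rw [Pi.mul_apply, norm_mul]
  exact mul_le_mul_of_nonneg_right (hC x) (norm_nonneg _)

theorem memLp_jetMul {μ : Measure (Euc n)} {η : Euc n → ℝ} {J : Jet n} {p : ℝ≥0∞}
    (hη : IsTestFunction univ η) (hJ : ∀ a, MemLp (J a) p μ) (a : JetIndex n) :
    MemLp (jetMul η J a) p μ := by
  have key : ∀ {ψ : Euc n → ℝ} (b : JetIndex n), IsTestFunction univ ψ → MemLp (ψ * J b) p μ :=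
    fun b hψ => memLp_mul_of_hasCompactSupport hψ.contDiff.continuous hψ.hasCompactSupport (hJ b)
  match a with
  | none => exact key _ hη
  | some (.inl i) => exact (key _ (hη.classicalPartial i)).add (key _ hη)
  | some (.inr (i, j)) =>
    exact ((key _ ((hη.classicalPartial i).classicalPartial j)).add
      (key _ (hη.classicalPartial i))).add ((key _ (hη.classicalPartial j)).add (key _ hη))

theorem jetMul_eq_zero {η : Euc n → ℝ} {J : Jet n} {x : Euc n}
    (h : x ∉ tsupport η ∨ ∀ a, J a x = 0) (a : JetIndex n) : jetMul η J a x = 0 := by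
  rcases h with h | h
  · have h0 : η x = 0 := image_eq_zero_of_notMem_tsupport h
    have h1 : ∀ i, classicalPartial i η x = 0 := fun i =>
      image_eq_zero_of_notMem_tsupport fun hx => h (tsupport_classicalPartial_subset η i hx)
    have h2 : ∀ i j, classicalPartial j (classicalPartial i η) x = 0 := fun i j =>
      image_eq_zero_of_notMem_tsupport fun hx => h (tsupport_classicalPartial_subset η i
        (tsupport_classicalPartial_subset _ j hx))
    match a with
    | none => simp [jetMul, h0]
    | some (.inl i) => simp [jetMul, h0, h1]
    | some (.inr (i, j)) => simp [jetMul, h0, h1, h2]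
  · match a with
    | none => simp [jetMul, h]
    | some (.inl i) => simp [jetMul, h]
    | some (.inr (i, j)) => simp [jetMul, h]

theorem jetMul_congr {η : Euc n → ℝ} {J K : Jet n} {x : Euc n}
    (h : ∀ a, J a x = K a x) (a : JetIndex n) : jetMul η J a x = jetMul η K a x := by
  match a with
  | none => simp [jetMul, h]
  | some (.inl i) => simp [jetMul, h]
  | some (.inr (i, j)) => simp [jetMul, h]

theorem classicalPartial_mollify_of_univ {i : Fin n} {u g ρ : Euc n → ℝ}
    (hu : HasWeakPartial univ i u g) (hρ : ContDiff ℝ ∞ ρ) (hc : HasCompactSupport ρ) :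
    classicalPartial i (mollify ρ u) = mollify ρ g := by
  funext x
  have hl : LocallyIntegrable u := locallyIntegrableOn_univ.1 hu.1
  have := hu.classicalPartial_mollify isOpen_univ (by rwa [indicator_univ]) hρ hc
    (x := x) (fun _ _ => mem_univ _)
  rwa [indicator_univ, indicator_univ] at this

theorem IsWeakJet.classicalJet_mollify {J : Jet n} {ρ : Euc n → ℝ} (hJ : IsWeakJet univ J)
    (hρ : ContDiff ℝ ∞ ρ) (hc : HasCompactSupport ρ) (a : JetIndex n) :
    classicalJet (mollify ρ (J none)) a = mollify ρ (J a) := by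
  match a with
  | none => rfl
  | some (.inl i) => exact classicalPartial_mollify_of_univ (hJ.1 i) hρ hc
  | some (.inr (i, j)) =>
    simp only [classicalJet]
    rw [classicalPartial_mollify_of_univ (hJ.1 i) hρ hc,
      classicalPartial_mollify_of_univ (hJ.2 i j) hρ hc]

theorem normW2_sub_eq (hΩ : IsOpen Ω) {J : Jet n} (hJ : IsWeakJet Ω J) {φ : Euc n → ℝ}
    (hφ : ContDiff ℝ ∞ φ) (p : ℝ≥0∞) :
    normW2 Ω p (J none - φ) = jetNorm Ω p (J - classicalJet φ) :=
  (hJ.sub (isWeakJet_classicalJet hφ)).normW2_eq hΩ p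

theorem MemW2Zero.exists_seq (hΩ : IsOpen Ω) {p : ℝ≥0∞} {w : Euc n → ℝ} (hw : MemW2Zero Ω p w) :
    ∃ φ : ℕ → Euc n → ℝ, (∀ k, IsTestFunction Ω (φ k)) ∧
      ∀ a, Filter.Tendsto (fun k => eLpNorm (weakJet Ω w a - classicalJet (φ k) a) p
        (volume.restrict Ω)) Filter.atTop (nhds 0) := by
  have h0 : Filter.Tendsto (fun k : ℕ => ((k : ℝ≥0∞))⁻¹) Filter.atTop (nhds 0) :=
    ENNReal.tendsto_inv_nat_nhds_zero
  choose φ hφ hlt using fun k : ℕ => hw.2 ((k : ℝ≥0∞)⁻¹) (by simp)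
  refine ⟨φ, hφ, fun a => tendsto_of_tendsto_of_tendsto_of_le_of_le tendsto_const_nhds h0
    (fun _ => zero_le) fun k => ?_⟩
  have h1 := normW2_sub_eq hΩ (hw.1.isWeakJet hΩ) (hφ k).contDiff p
  exact (eLpNorm_le_jetNorm p (weakJet Ω w - classicalJet (φ k)) a).trans
    (h1.symm.le.trans (hlt k).le)

theorem continuous_classicalJet {φ : Euc n → ℝ} (hφ : ContDiff ℝ ∞ φ) (a : JetIndex n) :
    Continuous (classicalJet φ a) := by
  match a with
  | none => exact hφ.continuous
  | some (.inl i) => exact (contDiff_classicalPartial hφ i).continuous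
  | some (.inr (i, j)) =>
    exact (contDiff_classicalPartial (contDiff_classicalPartial hφ i) j).continuous

theorem classicalJet_eq_zero {φ : Euc n → ℝ} {x : Euc n} (h : x ∉ tsupport φ) (a : JetIndex n) :
    classicalJet φ a x = 0 := by
  match a with
  | none => exact image_eq_zero_of_notMem_tsupport h
  | some (.inl i) =>
    exact image_eq_zero_of_notMem_tsupport fun hx => h (tsupport_classicalPartial_subset φ i hx)
  | some (.inr (i, j)) =>
    exact image_eq_zero_of_notMem_tsupport fun hx => h (tsupport_classicalPartial_subset φ i
        (tsupport_classicalPartial_subset _ j hx))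

/-- The extension by zero of an element of `W_0^{2,p}` has weak derivatives in the whole space. -/
theorem MemW2Zero.isWeakJet_indicator (hΩ : IsOpen Ω) (hfin : volume Ω ≠ ⊤) {p : ℝ≥0∞}
    (hp : 1 ≤ p) {w : Euc n → ℝ} (hw : MemW2Zero Ω p w) :
    IsWeakJet univ (fun a => Ω.indicator (weakJet Ω w a)) := by
  have : IsFiniteMeasure (volume.restrict Ω) := ⟨by simpa using hfin.lt_top⟩
  obtain ⟨φ, hφ, hlim⟩ := hw.exists_seq hΩ
  have hw' := hw.1.isWeakJet hΩ
  have hLp : ∀ a, MemLp (weakJet Ω w a) p (volume.restrict Ω) := fun a => hw.1.memLp hΩ hw' rfl a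
  have hloc : ∀ a, LocallyIntegrableOn (Ω.indicator (weakJet Ω w a)) univ := fun a =>
    (((memLp_indicator_iff_restrict hΩ.measurableSet).2 (hLp a)).locallyIntegrable
      hp).locallyIntegrableOn _
  have hconv : ∀ a, Filter.Tendsto (fun k => eLpNorm (classicalJet (φ k) a
      - Ω.indicator (weakJet Ω w a)) 1 (volume.restrict univ)) Filter.atTop (nhds 0) := by
    intro a
    set c : ℝ≥0∞ := (volume.restrict Ω) univ ^ (1 / (1 : ℝ≥0∞).toReal - 1 / p.toReal) with hc
    have hc' : c ≠ ⊤ := by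
      rw [hc]
      refine ENNReal.rpow_ne_top_of_nonneg ?_ (measure_ne_top _ _)
      rcases eq_or_ne p ⊤ with rfl | hpt
      · simp
      · have : (1 : ℝ) ≤ p.toReal := by
          simpa using ENNReal.toReal_mono hpt hp
        have := (div_le_one (zero_lt_one.trans_le this)).2 this
        simpa using this
    have hlim' := ENNReal.Tendsto.mul_const (b := c) (hlim a) (Or.inr hc')
    rw [zero_mul] at hlim'
    refine tendsto_of_tendsto_of_tendsto_of_le_of_le tendsto_const_nhds hlim'
      (fun _ => zero_le) fun k => ?_
    -- Test functions vanish outside `Ω`, so the error on the whole space is the error on `Ω`. The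
    -- classical jets of the approximants thus converge in `L¹` of the whole space to the extended
    -- jet.
    have heq : classicalJet (φ k) a - Ω.indicator (weakJet Ω w a)
        = Ω.indicator (classicalJet (φ k) a - weakJet Ω w a) := by
      funext x
      by_cases hx : x ∈ Ω
      · simp [hx]
      · simp [hx, classicalJet_eq_zero (fun h => hx ((hφ k).tsupport_subset h))]
    rw [Measure.restrict_univ, heq, eLpNorm_indicator_eq_eLpNorm_restrict hΩ.measurableSet,
      ← eLpNorm_neg, neg_sub]
    refine eLpNorm_le_eLpNorm_mul_rpow_measure_univ hp ?_
    exact (hLp a).1.sub (continuous_classicalJet (hφ k).contDiff a).aestronglyMeasurable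
  have hjet := fun k => isWeakJet_classicalJet (Ω := univ) (hφ k).contDiff
  exact ⟨fun i => .of_tendsto (fun k => (hjet k).1 i) (hloc _) (hloc _) (hconv none)
      (hconv (some (.inl i))),
    fun i j => .of_tendsto (fun k => (hjet k).2 i j) (hloc _) (hloc _) (hconv (some (.inl i)))
      (hconv (some (.inr (i, j))))⟩

/-- Local approximation by test functions: a jet supported in the closure of `Ω` near a boundary
point is shifted into `Ω` and mollified. -/
theorem exists_local_approximation (hΩ : IsBoundedLipschitzDomain Ω) {x₀ : Euc n}
    (hx₀ : x₀ ∈ closure Ω) {p : ℝ≥0} (hp : 1 ≤ p) :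
    ∃ r > 0, ∀ J : Jet n, IsWeakJet univ J → (∀ a, MemLp (J a) p volume) →
      (∀ a, ∀ x ∉ Ω, J a x = 0) → ∀ η : Euc n → ℝ, ContDiff ℝ ∞ η →
      tsupport η ⊆ Metric.ball x₀ r → ∀ ε : ℝ≥0∞, 0 < ε →
      ∃ Φ, IsTestFunction Ω Φ ∧ ∀ a, eLpNorm (classicalJet Φ a - jetMul η J a) p volume ≤ ε := by
  obtain ⟨r, hr, e, κ, hκ, he, hκ1, hcone⟩ := hΩ.exists_cone hx₀
  refine ⟨r, hr, fun J hJ hLp hJ0 η hη hηs ε hε => ?_⟩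
  have hηc : HasCompactSupport η :=
    Metric.isCompact_of_isClosed_isBounded (isClosed_tsupport _) (Metric.isBounded_ball.subset hηs)
  have hηt : IsTestFunction univ η := ⟨hη, hηc, subset_univ _⟩
  have hJ' := hJ.jetMul isOpen_univ hη
  have hLp' := memLp_jetMul hηt hLp
  choose δ hδ happ using fun a => exists_forall_eLpNorm_mollify_sub_le hp (hLp' a) hε
  obtain ⟨δ₀, hδ₀, hδle⟩ : ∃ δ₀ > 0, ∀ a, δ₀ ≤ δ a := by
    refine ⟨Finset.univ.inf' Finset.univ_nonempty δ, ?_, fun a => Finset.inf'_le _ (by simp)⟩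
    exact (Finset.lt_inf'_iff _).2 fun a _ => hδ a
  -- The shift must stay below `r` for the cone property, and `‖s • e‖ + κ * s ≤ 2 * s` must stay
  -- below `δ₀` for the approximation in `L^p`.
  set s : ℝ := min (r / 2) (δ₀ / 4) with hs
  have hs0 : 0 < s := by positivity
  have hsr : s < r := (min_le_left _ _).trans_lt (by linarith)
  have hsδ : s ≤ δ₀ / 4 := min_le_right _ _
  have hκs : 0 < κ * s := by positivity
  -- Convolution with this bump spreads each point `x` over the ball of radius `κ * s` about `x + s
  -- • e`. For `x` in the closure of `Ω` near `x₀` the cone property puts that closed ball inside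
  -- `Ω`.
  let φ : ContDiffBump (s • e) := ⟨κ * s / 2, κ * s, by linarith, by linarith⟩
  have hφ : ContDiff ℝ ∞ (φ.normed volume) := φ.contDiff_normed
  have hφc : HasCompactSupport (φ.normed volume) := φ.hasCompactSupport_normed
  have hK : IsCompact (tsupport η ∩ closure Ω) := hηc.inter_right isClosed_closure
  have hzero : ∀ x ∉ tsupport η ∩ closure Ω, jetMul η J none x = 0 := by
    intro x hx
    refine jetMul_eq_zero ?_ none
    by_cases h : x ∈ tsupport η
    · exact Or.inr fun a => hJ0 a x fun hxΩ => hx ⟨h, subset_closure hxΩ⟩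
    · exact Or.inl h
  have hts := tsupport_mollify_subset hφc hK hzero
  have hin : tsupport (mollify (φ.normed volume) (jetMul η J none)) ⊆ Ω := by
    intro y hy
    obtain ⟨x, hx, z, hz, rfl⟩ := hts hy
    rw [φ.tsupport_normed_eq, Metric.mem_closedBall, dist_eq_norm] at hz
    have := hcone x hx.2 (hηs hx.1) s hs0 hsr (z - s • e) hz
    rwa [add_assoc, add_sub_cancel] at this
  refine ⟨mollify (φ.normed volume) (jetMul η J none), ⟨contDiff_mollify hφ hφc
    ((hLp' none).locallyIntegrable (by exact_mod_cast hp)), ?_, hin⟩, fun a => ?_⟩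
  · exact Metric.isCompact_of_isClosed_isBounded (isClosed_tsupport _) (hΩ.isBounded.subset hin)
  · rw [hJ'.classicalJet_mollify hφ hφc]
    refine happ a _ φ (lt_of_lt_of_le ?_ (hδle a))
    have h1 : ‖s • e‖ ≤ s := by
      rw [norm_smul, Real.norm_of_nonneg hs0.le]
      exact mul_le_of_le_one_right hs0.le he
    have h2 : φ.rOut ≤ s := by
      change κ * s ≤ s
      exact mul_le_of_le_one_left hs0.le hκ1
    linarith

end ZeroBoundary


/-! ### From `W_0^{2,q} ∩ W^{2,p}` to `W_0^{2,p}`. -/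

section ZeroBoundaryIntegrability

variable {n : ℕ} {Ω : Set (Euc n)}

theorem IsBoundedLipschitzDomain.volume_ne_top (hΩ : IsBoundedLipschitzDomain Ω) :
    volume Ω ≠ ⊤ := hΩ.isBounded.measure_lt_top.ne

theorem IsBoundedLipschitzDomain.isCompact_closure (hΩ : IsBoundedLipschitzDomain Ω) :
    IsCompact (closure Ω) := hΩ.isBounded.isCompact_closure

theorem MemW2.mono_exponent (hfin : volume Ω ≠ ⊤) {p q : ℝ≥0∞} (hpq : p ≤ q) {u : Euc n → ℝ}
    (hu : MemW2 Ω q u) : MemW2 Ω p u := by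
  have : IsFiniteMeasure (volume.restrict Ω) := ⟨by simpa using hfin.lt_top⟩
  refine ⟨hu.1.mono_exponent hpq, fun i => ?_⟩
  obtain ⟨g, hg, hg1, hg2⟩ := hu.2 i
  refine ⟨g, hg, hg1.mono_exponent hpq, fun j => ?_⟩
  obtain ⟨h, hh, hh'⟩ := hg2 j
  exact ⟨h, hh, hh'.mono_exponent hpq⟩

/-- In a bounded Lipschitz domain, elements of `W_0^{2,q}` with derivatives of higher
integrability `p` belong to `W_0^{2,p}`. -/
theorem MemW2Zero.of_memW2 (hΩ : IsBoundedLipschitzDomain Ω) {p : ℝ≥0} {q : ℝ≥0∞} (hp : 1 ≤ p)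
    (hq : 1 ≤ q) {w : Euc n → ℝ} (hw : MemW2Zero Ω q w) (hwp : MemW2 Ω p w) :
    MemW2Zero Ω p w := by
  refine ⟨hwp, fun ε hε => ?_⟩
  -- The boundary condition enters only here: the zero extension has weak derivatives on the whole
  -- space. Its integrability to the power `p` comes from `hwp`.
  have hJ := hw.isWeakJet_indicator hΩ.isOpen hΩ.volume_ne_top hq
  set J : Jet n := fun a => Ω.indicator (weakJet Ω w a) with hJdef
  have hwJ := hwp.isWeakJet hΩ.isOpen
  have hLp : ∀ a, MemLp (J a) p volume := fun a =>
    (memLp_indicator_iff_restrict hΩ.isOpen.measurableSet).2 (hwp.memLp hΩ.isOpen hwJ rfl a)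
  have hJ0 : ∀ a, ∀ x ∉ Ω, J a x = 0 := fun a x hx => indicator_of_notMem hx _
  choose! r hr happ using fun x₀ (hx₀ : x₀ ∈ closure Ω) =>
    exists_local_approximation hΩ hx₀ hp
  obtain ⟨t, ht, hcov⟩ := hΩ.isCompact_closure.elim_nhds_subcover (fun x => Metric.ball x (r x))
    fun x hx => Metric.ball_mem_nhds x (hr x hx)
  obtain ⟨f, hf⟩ := SmoothPartitionOfUnity.exists_isSubordinate (modelWithCornersSelf ℝ (Euc n))
    (isClosed_closure (s := Ω)) (fun x : t => Metric.ball (x : Euc n) (r x))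
    (fun _ => Metric.isOpen_ball) (fun x hx => by
      obtain ⟨y, hy, hxy⟩ := mem_iUnion₂.1 (hcov hx)
      exact mem_iUnion.2 ⟨⟨y, hy⟩, hxy⟩)
  have hη : ∀ i, ContDiff ℝ ∞ (f i) := fun i => (f i).contMDiff.contDiff
  obtain ⟨ε', hε', hlt⟩ : ∃ ε' : ℝ≥0∞, 0 < ε' ∧
      (Fintype.card (JetIndex n) : ℝ≥0∞) * (Fintype.card t * ε') < ε := by
    obtain ⟨ε₁, h1, h2⟩ := exists_between hε
    set N : ℝ≥0∞ := (Fintype.card (JetIndex n) : ℝ≥0∞) * Fintype.card t with hN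
    have hNt : N ≠ ⊤ := ENNReal.mul_ne_top (ENNReal.natCast_ne_top _) (ENNReal.natCast_ne_top _)
    refine ⟨ε₁ / N, ENNReal.div_pos h1.ne' hNt, ?_⟩
    rw [← mul_assoc]
    exact ENNReal.mul_div_le.trans_lt h2
  choose Φ hΦ hΦle using fun i : t => happ i (ht i i.2) J hJ hLp hJ0 (f i) (hη i) (hf i) ε' hε'
  refine ⟨∑ i, Φ i, isTestFunction_sum _ fun i _ => hΦ i, lt_of_le_of_lt ?_ hlt⟩
  have hsum : ContDiff ℝ ∞ (∑ i, Φ i) :=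
    (isTestFunction_sum Finset.univ fun i _ => hΦ i).contDiff
  set K : Jet n := ∑ i : t, (jetMul (f i) (weakJet Ω w) - classicalJet (Φ i)) with hK
  have hKJ : IsWeakJet Ω K := isWeakJet_sum _ fun i _ =>
    (hwJ.jetMul hΩ.isOpen (hη i)).sub (isWeakJet_classicalJet (hΦ i).contDiff)
  -- On `Ω` the partition of unity sums to one, so the zeroth entries agree. Uniqueness of weak
  -- derivatives then gives equality of all entries, without summing the product rule terms.
  have hnone : (weakJet Ω w - classicalJet (∑ i, Φ i)) none =ᵐ[volume.restrict Ω] K none := by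
    filter_upwards [ae_restrict_mem hΩ.isOpen.measurableSet] with x hx
    have h1 : ∑ i : t, f i x = 1 := by
      rw [← finsum_eq_sum_of_fintype]
      exact f.sum_eq_one (subset_closure hx)
    simp only [hK, Finset.sum_apply, Pi.sub_apply, Finset.sum_sub_distrib]
    have h2 : ∀ i : t, jetMul (f i) (weakJet Ω w) none x = f i x * weakJet Ω w none x :=
      fun _ => rfl
    have h3 : classicalJet (∑ i, Φ i) none x = ∑ i, classicalJet (Φ i) none x := by
      simp [classicalJet]
    simp only [h2, ← Finset.sum_mul, h1, one_mul, h3]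
  have hae := ((hwJ.sub (isWeakJet_classicalJet hsum)).ae_eq hΩ.isOpen hKJ hnone)
  have hterm : ∀ a, eLpNorm (K a) p (volume.restrict Ω) ≤ Fintype.card t * ε' := by
    intro a
    have e1 : K a = ∑ i : t, (jetMul (f i) (weakJet Ω w) a - classicalJet (Φ i) a) := by
      simp [hK, Finset.sum_apply]
    have e2 : ∀ i : t, eLpNorm (jetMul (f i) (weakJet Ω w) a - classicalJet (Φ i) a) p
        (volume.restrict Ω) ≤ ε' := by
      intro i
      refine le_trans (le_of_eq ?_) ((eLpNorm_mono_measure _ (Measure.restrict_le_self (s := Ω))).trans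
        (hΦle i a))
      rw [← eLpNorm_neg, neg_sub]
      refine eLpNorm_congr_ae ?_
      filter_upwards [ae_restrict_mem hΩ.isOpen.measurableSet] with x hx
      rw [Pi.sub_apply, Pi.sub_apply,
        jetMul_congr (J := J) (K := weakJet Ω w) (fun b => indicator_of_mem hx _)]
    rw [e1]
    refine (eLpNorm_sum_le (fun i _ => ?_) (by exact_mod_cast hp)).trans
      ((Finset.sum_le_sum fun i _ => e2 i).trans ?_)
    · have hηt : IsTestFunction univ (f i) :=
        ⟨hη i, Metric.isCompact_of_isClosed_isBounded (isClosed_tsupport _)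
          (Metric.isBounded_ball.subset (hf i)), subset_univ _⟩
      exact (memLp_jetMul hηt (hwp.memLp hΩ.isOpen hwJ rfl) a).1.sub
        (continuous_classicalJet (hΦ i).contDiff a).aestronglyMeasurable
    · simp
  have hnorm := normW2_sub_eq hΩ.isOpen hwJ hsum p
  calc normW2 Ω p (w - ∑ i, Φ i) = jetNorm Ω p (weakJet Ω w - classicalJet (∑ i, Φ i)) := hnorm
    _ = ∑ a, eLpNorm (K a) p (volume.restrict Ω) :=
        Finset.sum_congr rfl fun a _ => eLpNorm_congr_ae (hae a)
    _ ≤ ∑ _a : JetIndex n, Fintype.card t * ε' := Finset.sum_le_sum fun a _ => hterm a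
    _ = (Fintype.card (JetIndex n) : ℝ≥0∞) * (Fintype.card t * ε') := by
        rw [Finset.sum_const, nsmul_eq_mul, Finset.card_univ]

end ZeroBoundaryIntegrability


/-! ### Morrey's inequality and the embedding into bounded functions. -/

section Morrey

variable {n : ℕ} {Ω : Set (Euc n)}

theorem map_homothety_volume (x : Euc n) {t : ℝ} (ht : 0 < t) :
    Measure.map (fun y => x + t • (y - x)) volume
      = ENNReal.ofReal |(t ^ n)⁻¹| • (volume : Measure (Euc n)) := by
  have h1 : (fun y : Euc n => x + t • (y - x)) = (fun z => (x - t • x) + z) ∘ fun y => t • y := by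
    funext y
    simp only [Function.comp_apply, smul_sub]
    abel
  rw [h1, ← Measure.map_map (by fun_prop) (by fun_prop),
    Measure.map_addHaar_smul volume ht.ne', Measure.map_smul, map_add_left_eq_self,
    finrank_euclideanSpace_fin]

/-- The scaling factor of the `L^p` norm under the homothety of ratio `t`. -/
noncomputable def homothetyFactor (n : ℕ) (p : ℝ≥0) (t : ℝ) : ℝ≥0∞ :=
  ENNReal.ofReal |(t ^ n)⁻¹| ^ (1 / (p : ℝ≥0∞)).toReal

/-- The constant in Morrey's inequality. -/
noncomputable def morreyConst (n : ℕ) (p : ℝ≥0) : ℝ≥0∞ :=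
  ∫⁻ t in Ioc (0 : ℝ) 1, homothetyFactor n p t

theorem homothetyFactor_eq {p : ℝ≥0} {t : ℝ} (ht : 0 < t) :
    homothetyFactor n p t = ENNReal.ofReal (t ^ (-(n / p : ℝ))) := by
  rw [homothetyFactor, abs_of_pos (by positivity), one_div, ENNReal.toReal_inv,
    ENNReal.coe_toReal,
    ENNReal.ofReal_rpow_of_nonneg (by positivity) (by positivity), ← Real.rpow_natCast,
    ← Real.rpow_neg ht.le, ← Real.rpow_mul ht.le]
  congr 2
  ring

/-- The integrand is `t ^ (-n/p)`, which is integrable at zero because `n < p`. This is the source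
of the condition `p > n` in the embeddings. -/
theorem morreyConst_ne_top {p : ℝ≥0} (hp : (n : ℝ≥0) < p) : morreyConst n p ≠ ⊤ := by
  have hp0 : (0 : ℝ) < p := lt_of_le_of_lt (Nat.cast_nonneg n) (by exact_mod_cast hp)
  have h1 : (-1 : ℝ) < -(n / p : ℝ) := by
    rw [neg_lt_neg_iff, div_lt_one hp0]
    exact_mod_cast hp
  have h2 := (intervalIntegral.intervalIntegrable_rpow' (a := 0) (b := 1) h1).1
  have h3 := h2.2.ne
  refine ne_top_of_le_ne_top h3 (le_of_eq ?_)
  refine setLIntegral_congr_fun measurableSet_Ioc fun t ht => ?_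
  rw [homothetyFactor_eq ht.1, Real.enorm_eq_ofReal (Real.rpow_nonneg ht.1.le _)]

/-- The homothety pushes Lebesgue measure on `B` to at most `t⁻ⁿ` times Lebesgue measure on `K`; the
`p`-th root of this density is the factor. -/
theorem eLpNorm_comp_homothety_le {F : Type*} [NormedAddCommGroup F] {g : Euc n → F}
    (hg : Continuous g) (p : ℝ≥0) {x : Euc n}
    {B K : Set (Euc n)} (hK : MeasurableSet K) {t : ℝ} (ht : 0 < t)
    (h : ∀ y ∈ B, x + t • (y - x) ∈ K) :
    eLpNorm (fun y => g (x + t • (y - x))) p (volume.restrict B)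
      ≤ homothetyFactor n p t * eLpNorm g p (volume.restrict K) := by
  set T : Euc n → Euc n := fun y => x + t • (y - x) with hT
  have hTm : Measurable T := by fun_prop
  have hle : Measure.map T (volume.restrict B)
      ≤ ENNReal.ofReal |(t ^ n)⁻¹| • volume.restrict K := by
    rw [← Measure.restrict_smul, ← map_homothety_volume x ht, Measure.restrict_map hTm hK]
    exact Measure.map_mono (Measure.restrict_mono (fun y hy => h y hy) le_rfl) hTm
  have h1 : eLpNorm (g ∘ T) p (volume.restrict B)
      = eLpNorm g p (Measure.map T (volume.restrict B)) :=
    (eLpNorm_map_measure hg.aestronglyMeasurable hTm.aemeasurable).symm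
  calc eLpNorm (g ∘ T) p (volume.restrict B)
      ≤ eLpNorm g p (ENNReal.ofReal |(t ^ n)⁻¹| • volume.restrict K) :=
        h1.le.trans (eLpNorm_mono_measure g hle)
    _ = _ := by
        rw [eLpNorm_smul_measure_of_ne_top ENNReal.coe_ne_top, smul_eq_mul]
        rfl

theorem enorm_sub_le_lintegral_fderiv {u : Euc n → ℝ} (hu : ContDiff ℝ 1 u) (x y : Euc n) :
    ‖u y - u x‖ₑ ≤ ∫⁻ t in Ioc (0 : ℝ) 1, ‖fderiv ℝ u (x + t • (y - x))‖ₑ * ‖y - x‖ₑ := by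
  have hc := hu.continuous_fderiv one_ne_zero
  have hd : ∀ t : ℝ, HasDerivAt (fun t : ℝ => u (x + t • (y - x)))
      (fderiv ℝ u (x + t • (y - x)) (y - x)) t := by
    intro t
    have h1 : HasDerivAt (fun t : ℝ => x + t • (y - x)) (y - x) t := by
      simpa using ((hasDerivAt_id t).smul_const (y - x)).const_add x
    exact (hu.differentiable one_ne_zero _).hasFDerivAt.comp_hasDerivAt t h1
  have hcont : Continuous fun t : ℝ => fderiv ℝ u (x + t • (y - x)) (y - x) :=
    (hc.comp (by fun_prop)).clm_apply continuous_const
  have hi := intervalIntegral.integral_eq_sub_of_hasDerivAt (a := 0) (b := 1)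
    (fun t _ => hd t) (hcont.intervalIntegrable _ _)
  simp only [one_smul, zero_smul, add_zero, add_sub_cancel] at hi
  rw [← hi, intervalIntegral.integral_of_le zero_le_one]
  refine (enorm_integral_le_lintegral_enorm _).trans (lintegral_mono fun t => ?_)
  exact ContinuousLinearMap.le_opENorm _ _

/-- Morrey's inequality for continuously differentiable functions. -/
theorem lintegral_enorm_sub_le {u : Euc n → ℝ} (hu : ContDiff ℝ 1 u) {p : ℝ≥0} (hp : 1 ≤ p)
    {x : Euc n} {B K : Set (Euc n)} (hK : MeasurableSet K) {D : ℝ≥0∞}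
    (hD : ∀ y ∈ B, ‖y - x‖ₑ ≤ D) (hB : MeasurableSet B)
    (h : ∀ y ∈ B, ∀ t ∈ Ioc (0 : ℝ) 1, x + t • (y - x) ∈ K) :
    ∫⁻ y in B, ‖u y - u x‖ₑ ≤ morreyConst n p * (eLpNorm (fderiv ℝ u) p (volume.restrict K)
      * volume B ^ (1 - 1 / (p : ℝ)) * D) := by
  have hc := hu.continuous_fderiv one_ne_zero
  have hm : Continuous fun q : Euc n × ℝ => ‖fderiv ℝ u (x + q.2 • (q.1 - x))‖ₑ :=
    (hc.comp (by fun_prop)).enorm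
  calc ∫⁻ y in B, ‖u y - u x‖ₑ
      ≤ ∫⁻ y in B, ∫⁻ t in Ioc (0 : ℝ) 1, ‖fderiv ℝ u (x + t • (y - x))‖ₑ * D := by
        refine setLIntegral_mono' hB fun y hy => (enorm_sub_le_lintegral_fderiv hu x y).trans ?_
        exact lintegral_mono fun t => by gcongr; exact hD y hy
    _ = ∫⁻ t in Ioc (0 : ℝ) 1, ∫⁻ y in B, ‖fderiv ℝ u (x + t • (y - x))‖ₑ * D :=
        lintegral_lintegral_swap (hm.measurable.mul_const D).aemeasurable
    -- At fixed `t`, Hölder's inequality on `B` is followed by rescaling to `K`; only the scaling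
    -- factor still depends on `t`.
    _ ≤ ∫⁻ t in Ioc (0 : ℝ) 1, homothetyFactor n p t *
          (eLpNorm (fderiv ℝ u) p (volume.restrict K) * volume B ^ (1 - 1 / (p : ℝ)) * D) := by
        refine setLIntegral_mono' measurableSet_Ioc fun t ht => ?_
        have hct : Continuous fun y => fderiv ℝ u (x + t • (y - x)) := hc.comp (by fun_prop)
        rw [lintegral_mul_const _ hct.enorm.measurable]
        have h1 := eLpNorm_le_eLpNorm_mul_rpow_measure_univ (p := 1) (q := p)
          (μ := volume.restrict B) (by exact_mod_cast hp) hct.aestronglyMeasurable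
        have h2 := eLpNorm_comp_homothety_le hc p hK ht.1 (fun y hy => h y hy t ht)
        rw [eLpNorm_one_eq_lintegral_enorm, Measure.restrict_apply_univ, ENNReal.toReal_one,
          div_one, ENNReal.coe_toReal] at h1
        calc _ ≤ homothetyFactor n p t * eLpNorm (fderiv ℝ u) p (volume.restrict K)
              * volume B ^ (1 - 1 / (p : ℝ)) * D := by
              gcongr
              exact h1.trans (by gcongr)
          _ = _ := by ring
    _ = _ := by
        rw [lintegral_mul_const, morreyConst]
        unfold homothetyFactor
        fun_prop

/-- The triangle inequality integrated over `y ∈ B`. With Morrey's bound on the last integral it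
turns integral control into control at the single point `x`. -/
theorem volume_mul_enorm_le {u : Euc n → ℝ} (hu : Continuous u) (x : Euc n) {B : Set (Euc n)} :
    volume B * ‖u x‖ₑ ≤ (∫⁻ y in B, ‖u y‖ₑ) + ∫⁻ y in B, ‖u y - u x‖ₑ := by
  rw [← lintegral_add_left hu.enorm.measurable]
  calc volume B * ‖u x‖ₑ = ∫⁻ _ in B, ‖u x‖ₑ := by
        rw [setLIntegral_const, mul_comm]
    _ ≤ _ := lintegral_mono fun y => by
        have : u x = u y - (u y - u x) := by ring
        calc ‖u x‖ₑ = ‖u y - (u y - u x)‖ₑ := by rw [← this]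
          _ ≤ _ := enorm_sub_le

theorem norm_fderiv_le_sum (u : Euc n → ℝ) (x : Euc n) :
    ‖fderiv ℝ u x‖ ≤ ∑ i, ‖classicalPartial i u x‖ := by
  refine ContinuousLinearMap.opNorm_le_bound _ (Finset.sum_nonneg fun _ _ => norm_nonneg _)
    fun v => ?_
  have hv : v = ∑ i, v i • EuclideanSpace.single i (1 : ℝ) := by
    have := (EuclideanSpace.basisFun (Fin n) ℝ).sum_repr v
    simpa using this.symm
  conv_lhs => rw [hv]
  rw [map_sum, Finset.sum_mul]
  refine (norm_sum_le _ _).trans (Finset.sum_le_sum fun i _ => ?_)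
  rw [map_smul, norm_smul, mul_comm]
  exact mul_le_mul_of_nonneg_left (PiLp.norm_apply_le v i) (norm_nonneg _)

theorem eLpNorm_fderiv_le_sum {u : Euc n → ℝ} (hu : ContDiff ℝ 1 u) {p : ℝ≥0} (hp : 1 ≤ p)
    (μ : Measure (Euc n)) :
    eLpNorm (fderiv ℝ u) p μ ≤ ∑ i, eLpNorm (classicalPartial i u) p μ := by
  calc eLpNorm (fderiv ℝ u) p μ ≤ eLpNorm (∑ i, fun x => ‖classicalPartial i u x‖) p μ := by
        refine eLpNorm_mono_real fun x => ?_
        rw [Finset.sum_apply]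
        exact norm_fderiv_le_sum u x
    _ ≤ ∑ i, eLpNorm (fun x => ‖classicalPartial i u x‖) p μ :=
        eLpNorm_sum_le (fun i _ =>
          (continuous_classicalPartial hu i).norm.aestronglyMeasurable) (by exact_mod_cast hp)
    _ = _ := by simp only [eLpNorm_norm]

/-- Morrey's embedding: in a bounded Lipschitz domain, functions in `W^{1,p}` with `p > n` are
essentially bounded. -/
theorem exists_ae_norm_le (hΩ : IsBoundedLipschitzDomain Ω) {p : ℝ≥0} (hp : 1 ≤ p)
    (hnp : (n : ℝ≥0) < p) {u : Euc n → ℝ} {g : Fin n → Euc n → ℝ}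
    (hg : ∀ i, HasWeakPartial Ω i u (g i)) (hu : MemLp u p (volume.restrict Ω))
    (hgp : ∀ i, MemLp (g i) p (volume.restrict Ω)) :
    ∃ C : ℝ, ∀ᵐ x ∂(volume.restrict Ω), ‖u x‖ ≤ C := by
  have hΩm := hΩ.isOpen.measurableSet
  have : IsFiniteMeasure (volume.restrict Ω) := ⟨by simpa using hΩ.volume_ne_top.lt_top⟩
  have hu1 : MemLp (Ω.indicator u) 1 volume :=
    (memLp_indicator_iff_restrict hΩm).2 (hu.mono_exponent (by exact_mod_cast hp))
  have hgi : ∀ i, MemLp (Ω.indicator (g i)) p volume :=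
    fun i => (memLp_indicator_iff_restrict hΩm).2 (hgp i)
  have hloc : LocallyIntegrable (Ω.indicator u) := hu1.locallyIntegrable le_rfl
  set N : ℝ≥0∞ := ∑ i, eLpNorm (Ω.indicator (g i)) p volume with hN
  have hNt : N ≠ ⊤ := ENNReal.sum_ne_top.2 fun i _ => (hgi i).2.ne
  let φ : ℕ → ContDiffBump (0 : Euc n) := fun k =>
    ⟨1 / (2 * ((k : ℝ) + 1)), 1 / ((k : ℝ) + 1), by positivity,
      one_div_lt_one_div_of_lt (by positivity) (by linarith [k.cast_nonneg (α := ℝ)])⟩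
  have hφ0 : Filter.Tendsto (fun k => (φ k).rOut) Filter.atTop (nhds 0) :=
    tendsto_one_div_add_atTop_nhds_zero_nat
  -- A bounded ratio of outer to inner radius is what Lebesgue differentiation needs for the
  -- mollifications to converge almost everywhere.
  have hφK : ∀ k, (φ k).rOut ≤ 2 * (φ k).rIn := by
    intro k
    change 1 / ((k : ℝ) + 1) ≤ 2 * (1 / (2 * ((k : ℝ) + 1)))
    field_simp
    exact le_rfl
  have hae := ContDiffBump.ae_convolution_tendsto_right_of_locallyIntegrable (μ := volume)
    hφ0 (Filter.Eventually.of_forall hφK) hloc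
  set U : ℕ → Euc n → ℝ := fun k => mollify ((φ k).normed volume) (Ω.indicator u) with hU
  have hUs : ∀ k, ContDiff ℝ ∞ (U k) := fun k =>
    contDiff_mollify (φ k).contDiff_normed (φ k).hasCompactSupport_normed hloc
  have local_bound : ∀ x₀ ∈ closure Ω, ∃ V ∈ nhds x₀, ∃ C : ℝ,
      ∀ᵐ x ∂(volume.restrict Ω), x ∈ V → ‖u x‖ ≤ C := by
    intro x₀ hx₀
    obtain ⟨r, hr, e, κ, hκ, he, hκ1, hcone⟩ := hΩ.exists_cone hx₀
    have hs : 0 < r / 2 := by positivity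
    have hsr : r / 2 < r := by linarith
    have hκs : 0 < κ * (r / 2) := by positivity
    set V : ℝ≥0∞ := volume (Metric.closedBall (0 : Euc n) (κ * (r / 2))) with hV
    have hV0 : V ≠ 0 := (Metric.measure_closedBall_pos _ _ hκs).ne'
    have hVt : V ≠ ⊤ := measure_closedBall_lt_top.ne
    -- The bound depends on `x₀` through the cone, but neither on the point `x` near `x₀` nor on the
    -- mollification index.
    set R : ℝ≥0∞ := eLpNorm (Ω.indicator u) 1 volume
      + morreyConst n p * (N * V ^ (1 - 1 / (p : ℝ)) * ENNReal.ofReal r) with hR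
    have hRt : R ≠ ⊤ := by
      refine ENNReal.add_ne_top.2 ⟨hu1.2.ne, ENNReal.mul_ne_top (morreyConst_ne_top hnp)
        (ENNReal.mul_ne_top (ENNReal.mul_ne_top hNt ?_) ENNReal.ofReal_ne_top)⟩
      exact ENNReal.rpow_ne_top_of_nonneg' hV0.bot_lt hVt
    refine ⟨Metric.ball x₀ r, Metric.ball_mem_nhds _ hr, (R / V).toReal, ?_⟩
    filter_upwards [ae_restrict_mem hΩm, ae_restrict_of_ae hae] with x hxΩ hlim hxr
    have hVx : ∀ y : Euc n, volume (Metric.closedBall y (κ * (r / 2))) = V := fun y =>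
      Measure.addHaar_closedBall_center _ _ _
    set B := Metric.closedBall (x + (r / 2) • e) (κ * (r / 2)) with hB
    -- The union of the segments from `x` to the ball `B` in the cone at `x`. It is compact and
    -- contained in `Ω`, so it has positive distance to the complement, and on it fine mollification
    -- commutes with weak derivatives.
    set K : Set (Euc n) := (fun q : ℝ × Euc n => x + q.1 • (q.2 - x)) '' (Icc 0 1 ×ˢ B) with hK
    have hKc : IsCompact K :=
      (isCompact_Icc.prod (isCompact_closedBall _ _)).image (by fun_prop)
    have hKΩ : K ⊆ Ω := by
      rintro _ ⟨⟨t, y⟩, ⟨ht, hy⟩, rfl⟩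
      rcases ht.1.eq_or_lt with h0 | h0
      · have h0' : t = 0 := h0.symm
        simpa [h0'] using hxΩ
      · have hy' : ‖y - (x + (r / 2) • e)‖ ≤ κ * (r / 2) := by
          rwa [← dist_eq_norm]
        -- The cone property at scale `t * (r / 2)`: the point at parameter `t` of the segment
        -- towards `y` is the rescaled copy of `y`.
        have := hcone x (subset_closure hxΩ) hxr (t * (r / 2)) (by positivity)
          (by nlinarith [ht.2]) (t • (y - (x + (r / 2) • e))) (by
            rw [norm_smul, Real.norm_of_nonneg h0.le]
            calc t * _ ≤ t * (κ * (r / 2)) := by gcongr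
              _ = _ := by ring)
        convert this using 1
        simp only
        module
    obtain ⟨δ, hδ, hδΩ⟩ := hKc.exists_cthickening_subset_open hΩ.isOpen hKΩ
    have hbound : ∀ᶠ k in Filter.atTop, V * ‖U k x‖ₑ ≤ R := by
      filter_upwards [hφ0.eventually (gt_mem_nhds hδ)] with k hk
      have hd : ∀ i, ∀ y ∈ K, classicalPartial i (U k) y
          = mollify ((φ k).normed volume) (Ω.indicator (g i)) y := by
        intro i y hy
        refine (hg i).classicalPartial_mollify hΩ.isOpen hloc (φ k).contDiff_normed
          (φ k).hasCompactSupport_normed fun z hz => hδΩ ?_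
        rw [(φ k).tsupport_normed_eq, mem_closedBall_zero_iff] at hz
        refine Metric.mem_cthickening_of_dist_le _ y _ _ hy ?_
        rw [dist_eq_norm, sub_sub_cancel_left, norm_neg]
        exact hz.trans hk.le
      have h1 : eLpNorm (fderiv ℝ (U k)) p (volume.restrict K) ≤ N := by
        refine (eLpNorm_fderiv_le_sum ((hUs k).of_le (by simp)) hp _).trans
          (Finset.sum_le_sum fun i _ => ?_)
        rw [eLpNorm_congr_ae (g := mollify ((φ k).normed volume) (Ω.indicator (g i)))
          (by filter_upwards [ae_restrict_mem hKc.measurableSet] with y hy using hd i y hy)]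
        exact (eLpNorm_mono_measure _ Measure.restrict_le_self).trans
          (eLpNorm_mollify_le (φ k) (hgi i).1 hp)
      have h2 : ∫⁻ y in B, ‖U k y‖ₑ ≤ eLpNorm (Ω.indicator u) 1 volume := by
        have := eLpNorm_mollify_le (φ k) hu1.1 (p := 1) le_rfl
        rw [ENNReal.coe_one] at this
        refine le_trans ?_ this
        rw [eLpNorm_one_eq_lintegral_enorm]
        exact setLIntegral_le_lintegral _ _
      have h3 := lintegral_enorm_sub_le ((hUs k).of_le (by simp)) hp (x := x) (B := B)
        hKc.measurableSet (D := ENNReal.ofReal r) (fun y hy => by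
          rw [← ofReal_norm]
          refine ENNReal.ofReal_le_ofReal ?_
          have hy' : ‖y - (x + (r / 2) • e)‖ ≤ κ * (r / 2) := by
            rwa [← dist_eq_norm]
          have h4 : ‖y - x‖ ≤ ‖y - (x + (r / 2) • e)‖ + ‖(r / 2) • e‖ := by
            refine le_trans (le_of_eq ?_) (norm_add_le _ _)
            congr 1
            abel
          have h5 : ‖(r / 2) • e‖ ≤ r / 2 := by
            rw [norm_smul, Real.norm_of_nonneg hs.le]
            exact mul_le_of_le_one_right hs.le he
          nlinarith) Metric.isClosed_closedBall.measurableSet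
        (fun y hy t ht => ⟨⟨t, y⟩, ⟨⟨ht.1.le, ht.2⟩, hy⟩, rfl⟩)
      rw [hVx] at h3
      calc V * ‖U k x‖ₑ = volume B * ‖U k x‖ₑ := by rw [hVx]
        _ ≤ _ := volume_mul_enorm_le (hUs k).continuous x
        _ ≤ R := add_le_add h2 (h3.trans (by gcongr))
    have hux : Filter.Tendsto (fun k => V * ‖U k x‖ₑ) Filter.atTop (nhds (V * ‖u x‖ₑ)) := by
      rw [indicator_of_mem hxΩ] at hlim
      exact ENNReal.Tendsto.const_mul hlim.enorm (Or.inr hVt)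
    have hle : V * ‖u x‖ₑ ≤ R := le_of_tendsto hux hbound
    have h6 : ‖u x‖ₑ ≤ R / V := by
      rwa [ENNReal.le_div_iff_mul_le (Or.inl hV0) (Or.inl hVt), mul_comm]
    have h7 := ENNReal.toReal_mono (ENNReal.div_ne_top hRt hV0) h6
    rwa [toReal_enorm] at h7
  choose! V hV C hC using local_bound
  obtain ⟨t, ht, hcov⟩ := hΩ.isCompact_closure.elim_nhds_subcover V hV
  refine ⟨∑ x ∈ t, |C x|, ?_⟩
  have hall : ∀ᵐ x ∂(volume.restrict Ω), ∀ y ∈ t, x ∈ V y → ‖u x‖ ≤ C y :=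
    (Finset.eventually_all t).2 fun y hy => hC y (ht y hy)
  filter_upwards [ae_restrict_mem hΩm, hall] with x hx h
  obtain ⟨y, hy, hxy⟩ := mem_iUnion₂.1 (hcov (subset_closure hx))
  exact (h y hy hxy).trans ((le_abs_self _).trans
    (Finset.single_le_sum (f := fun x => |C x|) (fun _ _ => abs_nonneg _) hy))

end Morrey


/-! ### Hölder bounds, Arzelà–Ascoli, and almost everywhere convergence. -/

section Compactness

variable {n : ℕ}

/-- Morrey's inequality: functions with gradient in `L^p`, `p > n`, are Hölder continuous. -/
theorem exists_holder_const {p : ℝ≥0} (hp : 1 ≤ p) (hnp : (n : ℝ≥0) < p) :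
    ∃ C : ℝ, ∀ (u : Euc n → ℝ), ContDiff ℝ 1 u → ∀ M : ℝ≥0,
      eLpNorm (fderiv ℝ u) p volume ≤ M → ∀ x y,
      dist (u x) (u y) ≤ C * M * dist x y ^ (1 - n / p : ℝ) := by
  set v : ℝ≥0∞ := volume (Metric.closedBall (0 : Euc n) 1) with hv
  have hv0 : v ≠ 0 := (Metric.measure_closedBall_pos _ _ one_pos).ne'
  have hvt : v ≠ ⊤ := measure_closedBall_lt_top.ne
  have hvr : 0 < v.toReal := ENNReal.toReal_pos hv0 hvt
  have hp0 : (0 : ℝ) < p := lt_of_lt_of_le one_pos (by exact_mod_cast hp)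
  have hexp : (0 : ℝ) < 1 - n / p := by
    rw [sub_pos, div_lt_one hp0]
    exact_mod_cast hnp
  -- The factor `4` comes from two applications of Morrey's bound, each with diameter `2 * δ`;
  -- dividing by `volume B` leaves the power `-1/p` of the volume, which gives `δ ^ (-n/p)`.
  refine ⟨4 * (morreyConst n p).toReal * v.toReal ^ (-(1 / p : ℝ)), fun u hu M hM x y => ?_⟩
  rcases (dist_nonneg (x := x) (y := y)).eq_or_lt with h0 | hδ
  · rw [← h0, Real.zero_rpow hexp.ne', mul_zero, dist_eq_zero.1 h0.symm, dist_self]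
  set δ := dist x y with hδdef
  set B := Metric.closedBall x δ with hB
  have hBm : MeasurableSet B := Metric.isClosed_closedBall.measurableSet
  have hVB : volume B = ENNReal.ofReal (δ ^ n) * v := by
    rw [hB, Measure.addHaar_closedBall' _ _ hδ.le, finrank_euclideanSpace_fin]
  have key : ∀ z ∈ B, ∫⁻ y in B, ‖u y - u z‖ₑ
      ≤ morreyConst n p * (M * volume B ^ (1 - 1 / (p : ℝ)) * ENNReal.ofReal (2 * δ)) := by
    intro z hz
    have h1 := lintegral_enorm_sub_le hu hp (x := z) (B := B) (K := univ) MeasurableSet.univ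
      (D := ENNReal.ofReal (2 * δ)) (fun y hy => by
        rw [← ofReal_norm]
        refine ENNReal.ofReal_le_ofReal ?_
        rw [← dist_eq_norm]
        have h2 := dist_triangle_right y z x
        rw [Metric.mem_closedBall] at hy hz
        linarith) hBm (fun _ _ _ _ => mem_univ _)
    rw [Measure.restrict_univ] at h1
    exact h1.trans (by gcongr)
  -- Applied to `u - u y` at `x`: the difference `u x - u y` is controlled by the mean deviations
  -- from `u y` and from `u x` over a ball containing both points.
  have h1 := volume_mul_enorm_le (u := fun z => u z - u y) (hu.continuous.sub continuous_const) x
    (B := B)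
  simp only [sub_sub_sub_cancel_right] at h1
  have h2 := h1.trans (add_le_add (key y (by rw [hB, Metric.mem_closedBall, dist_comm]))
    (key x (Metric.mem_closedBall_self hδ.le)))
  have hVt : volume B ≠ ⊤ := measure_closedBall_lt_top.ne
  have hV0 : volume B ≠ 0 := (Metric.measure_closedBall_pos _ _ hδ).ne'
  have hft : morreyConst n p * (M * volume B ^ (1 - 1 / (p : ℝ)) * ENNReal.ofReal (2 * δ)) ≠ ⊤ :=
    ENNReal.mul_ne_top (morreyConst_ne_top hnp) (ENNReal.mul_ne_top (ENNReal.mul_ne_top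
      ENNReal.coe_ne_top (ENNReal.rpow_ne_top_of_nonneg' hV0.bot_lt hVt)) ENNReal.ofReal_ne_top)
  have h3 := ENNReal.toReal_mono (ENNReal.add_ne_top.2 ⟨hft, hft⟩) h2
  rw [ENNReal.toReal_add hft hft] at h3
  simp only [ENNReal.toReal_mul, toReal_enorm, ← ENNReal.toReal_rpow, ENNReal.coe_toReal,
    ENNReal.toReal_ofReal (by positivity : (0 : ℝ) ≤ 2 * δ)] at h3
  set V := (volume B).toReal with hVdef
  have hVr : V = δ ^ n * v.toReal := by
    rw [hVdef, hVB, ENNReal.toReal_mul, ENNReal.toReal_ofReal (by positivity)]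
  have hVpos : 0 < V := ENNReal.toReal_pos hV0 hVt
  have h4 : V ^ (1 - 1 / (p : ℝ)) = V * V ^ (-(1 / p : ℝ)) := by
    rw [sub_eq_add_neg, Real.rpow_add hVpos, Real.rpow_one]
  have h5 : V ^ (-(1 / p : ℝ)) = δ ^ (-(n / p : ℝ)) * v.toReal ^ (-(1 / p : ℝ)) := by
    rw [hVr, Real.mul_rpow (by positivity) hvr.le, ← Real.rpow_natCast, ← Real.rpow_mul hδ.le]
    congr 2
    ring
  have h6 : δ ^ (1 - n / p : ℝ) = δ * δ ^ (-(n / p : ℝ)) := by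
    rw [sub_eq_add_neg, Real.rpow_add hδ, Real.rpow_one]
  rw [Real.dist_eq, ← Real.norm_eq_abs, h6]
  rw [h4, h5] at h3
  refine le_of_mul_le_mul_left (h3.trans (le_of_eq ?_)) hVpos
  ring

/-- Morrey's bound on the unit ball about `x`, whose volume does not depend on `x`. It supplies the
pointwise boundedness for Arzelà–Ascoli. -/
theorem exists_sup_bound {p : ℝ≥0} (hp : 1 ≤ p) (hnp : (n : ℝ≥0) < p) (M : ℝ≥0) :
    ∃ R : ℝ, ∀ (u : Euc n → ℝ), ContDiff ℝ 1 u → eLpNorm u p volume ≤ M →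
      eLpNorm (fderiv ℝ u) p volume ≤ M → ∀ x, ‖u x‖ ≤ R := by
  set v : ℝ≥0∞ := volume (Metric.closedBall (0 : Euc n) 1) with hv
  have hv0 : v ≠ 0 := (Metric.measure_closedBall_pos _ _ one_pos).ne'
  have hvt : v ≠ ⊤ := measure_closedBall_lt_top.ne
  have hvp : v ^ (1 - 1 / (p : ℝ)) ≠ ⊤ := ENNReal.rpow_ne_top_of_nonneg' hv0.bot_lt hvt
  set R : ℝ≥0∞ := M * v ^ (1 - 1 / (p : ℝ))
    + morreyConst n p * (M * v ^ (1 - 1 / (p : ℝ)) * 1) with hR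
  have hRt : R ≠ ⊤ := ENNReal.add_ne_top.2 ⟨ENNReal.mul_ne_top ENNReal.coe_ne_top hvp,
    ENNReal.mul_ne_top (morreyConst_ne_top hnp) (ENNReal.mul_ne_top
      (ENNReal.mul_ne_top ENNReal.coe_ne_top hvp) ENNReal.one_ne_top)⟩
  refine ⟨(R / v).toReal, fun u hu h1 h2 x => ?_⟩
  set B := Metric.closedBall x 1 with hB
  have hVB : volume B = v := Measure.addHaar_closedBall_center _ _ _
  have h3 := lintegral_enorm_sub_le hu hp (x := x) (B := B) (K := univ) MeasurableSet.univ
    (D := 1) (fun y hy => by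
      rw [← ofReal_norm, ← dist_eq_norm, ENNReal.ofReal_le_one]
      exact hy) Metric.isClosed_closedBall.measurableSet (fun _ _ _ _ => mem_univ _)
  have h4 : ∫⁻ y in B, ‖u y‖ₑ ≤ M * v ^ (1 - 1 / (p : ℝ)) := by
    have h5 := eLpNorm_le_eLpNorm_mul_rpow_measure_univ (p := 1) (q := p)
      (μ := volume.restrict B) (by exact_mod_cast hp) hu.continuous.aestronglyMeasurable
    rw [eLpNorm_one_eq_lintegral_enorm, Measure.restrict_apply_univ, ENNReal.toReal_one,
      div_one, ENNReal.coe_toReal, hVB] at h5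
    refine h5.trans ?_
    gcongr
    exact (eLpNorm_mono_measure _ Measure.restrict_le_self).trans h1
  rw [Measure.restrict_univ, hVB] at h3
  have h5 := (volume_mul_enorm_le hu.continuous x (B := B)).trans
    (add_le_add h4 (h3.trans (show _ ≤ morreyConst n p * (M * v ^ (1 - 1 / (p : ℝ)) * 1) by
      gcongr)))
  rw [hVB] at h5
  have h6 : ‖u x‖ₑ ≤ R / v := by
    rwa [ENNReal.le_div_iff_mul_le (Or.inl hv0) (Or.inl hvt), mul_comm]
  have h7 := ENNReal.toReal_mono (ENNReal.div_ne_top hRt hv0) h6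
  rwa [toReal_enorm] at h7

/-- Compactness of the embedding of `W^{1,p}` into continuous functions, for `p > n`. -/
theorem exists_subseq_tendstoUniformlyOn {ι : Type*} [Fintype ι] {p : ℝ≥0} (hp : 1 ≤ p)
    (hnp : (n : ℝ≥0) < p) {K : Set (Euc n)} (hK : IsCompact K) {ψ : ℕ → ι → Euc n → ℝ}
    (hψ : ∀ k i, ContDiff ℝ 1 (ψ k i)) {M : ℝ≥0} (h1 : ∀ k i, eLpNorm (ψ k i) p volume ≤ M)
    (h2 : ∀ k i, eLpNorm (fderiv ℝ (ψ k i)) p volume ≤ M) :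
    ∃ (f : ι → Euc n → ℝ) (σ : ℕ → ℕ), StrictMono σ ∧
      ∀ i, TendstoUniformlyOn (fun k => ψ (σ k) i) (f i) Filter.atTop K := by
  classical
  have : CompactSpace K := isCompact_iff_compactSpace.1 hK
  obtain ⟨C, hC⟩ := exists_holder_const (n := n) hp hnp
  obtain ⟨R, hR⟩ := exists_sup_bound (n := n) hp hnp M
  have hp0 : (0 : ℝ) < p := lt_of_lt_of_le one_pos (by exact_mod_cast hp)
  have hexp : (0 : ℝ) < 1 - n / p := by
    rw [sub_pos, div_lt_one hp0]
    exact_mod_cast hnp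
  -- The family is treated as one vector valued function, so that a single subsequence serves all
  -- its members.
  let F : ℕ → BoundedContinuousFunction K (ι → ℝ) := fun k =>
    BoundedContinuousFunction.mkOfCompact
      ⟨fun x i => ψ k i x, continuous_pi fun i => (hψ k i).continuous.comp continuous_subtype_val⟩
  have hR0 : ∀ k x, F k x ∈ Metric.closedBall (0 : ι → ℝ) |R| := by
    intro k x
    rw [mem_closedBall_zero_iff, pi_norm_le_iff_of_nonneg (abs_nonneg R)]
    exact fun i => (hR _ (hψ k i) (h1 k i) (h2 k i) x).trans (le_abs_self R)
  have hlim : Filter.Tendsto (fun δ : ℝ => |C| * M * δ ^ (1 - n / p : ℝ)) (nhds 0) (nhds 0) := by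
    have h := ((Real.continuousAt_rpow_const (0 : ℝ) (1 - n / p : ℝ)
      (Or.inr hexp.le)).tendsto).const_mul (|C| * M)
    rwa [Real.zero_rpow hexp.ne', mul_zero] at h
  have hcomp : IsCompact (closure (range F)) := by
    refine BoundedContinuousFunction.arzela_ascoli (Metric.closedBall (0 : ι → ℝ) |R|)
      (isCompact_closedBall _ _) (range F) ?_ ?_
    · rintro _ x ⟨k, rfl⟩
      exact hR0 k x
    · refine Metric.equicontinuous_of_continuity_modulus _ hlim _ ?_
      rintro x y ⟨_, k, rfl⟩
      have hnn : 0 ≤ |C| * M * dist x y ^ (1 - n / p : ℝ) := by positivity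
      refine (dist_pi_le_iff hnn).2 fun i => (hC _ (hψ k i) M (h2 k i) x y).trans ?_
      have := le_abs_self C
      rw [Subtype.dist_eq]
      gcongr
  obtain ⟨g, -, σ, hσ, hg⟩ := hcomp.tendsto_subseq (x := F) fun k => subset_closure ⟨k, rfl⟩
  refine ⟨fun i x => if hx : x ∈ K then g ⟨x, hx⟩ i else 0, σ, hσ, fun i => ?_⟩
  have hunif := BoundedContinuousFunction.tendsto_iff_tendstoUniformly.1 hg
  rw [Metric.tendstoUniformlyOn_iff]
  intro ε hε
  filter_upwards [Metric.tendstoUniformly_iff.1 hunif ε hε] with k hk x hx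
  rw [dif_pos hx]
  exact (dist_le_pi_dist _ _ i).trans_lt (hk ⟨x, hx⟩)

theorem tendsto_eLpNorm_of_tendstoUniformlyOn {μ : Measure (Euc n)} [IsFiniteMeasure μ]
    {K : Set (Euc n)} (hK : ∀ᵐ x ∂μ, x ∈ K) {f : ℕ → Euc n → ℝ} {g : Euc n → ℝ}
    (h : TendstoUniformlyOn f g Filter.atTop K) (p : ℝ≥0∞) :
    Filter.Tendsto (fun k => eLpNorm (f k - g) p μ) Filter.atTop (nhds 0) := by
  set c : ℝ≥0∞ := μ univ ^ p.toReal⁻¹ with hc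
  have hct : c ≠ ⊤ :=
    ENNReal.rpow_ne_top_of_nonneg (by positivity) (measure_ne_top _ _)
  rw [ENNReal.tendsto_nhds_zero]
  intro ε hε
  have h0 : Filter.Tendsto (fun δ : ℝ => c * ENNReal.ofReal δ) (nhds 0) (nhds 0) := by
    have := ENNReal.Tendsto.const_mul (a := c) (ENNReal.tendsto_ofReal
      (Filter.tendsto_id (x := nhds (0 : ℝ)))) (Or.inr hct)
    simpa using this
  obtain ⟨δ, hδε, hδ⟩ := (((h0.eventually (ge_mem_nhds hε)).filter_mono
    nhdsWithin_le_nhds).and (self_mem_nhdsWithin (a := (0 : ℝ)) (s := Ioi 0))).exists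
  filter_upwards [Metric.tendstoUniformlyOn_iff.1 h δ hδ] with k hk
  refine (eLpNorm_le_of_ae_bound (C := δ) ?_).trans hδε
  filter_upwards [hK] with x hx
  rw [Pi.sub_apply, ← dist_eq_norm, dist_comm]
  exact (hk x hx).le

/-- A sequence of finite families converging in `L^p` has a subsequence converging almost
everywhere. -/
theorem exists_subseq_ae_tendsto {X ι : Type*} [MeasurableSpace X] [Fintype ι] {μ : Measure X}
    {p : ℝ≥0∞} (hp : 1 ≤ p) {f : ℕ → ι → X → ℝ} {g : ι → X → ℝ}
    (hf : ∀ k i, AEStronglyMeasurable (f k i) μ) (hg : ∀ i, AEStronglyMeasurable (g i) μ)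
    (h : ∀ i, Filter.Tendsto (fun k => eLpNorm (f k i - g i) p μ) Filter.atTop (nhds 0)) :
    ∃ σ : ℕ → ℕ, StrictMono σ ∧ ∀ᵐ x ∂μ, ∀ i,
      Filter.Tendsto (fun k => f (σ k) i x) Filter.atTop (nhds (g i x)) := by
  -- The sum of the absolute errors dominates each of them, so one subsequence along which it tends
  -- to zero works for every index.
  have hF : ∀ k, AEStronglyMeasurable (∑ i, fun x => ‖f k i x - g i x‖) μ := fun k =>
    Finset.aestronglyMeasurable_sum _ fun i _ => ((hf k i).sub (hg i)).norm
  have hlim : Filter.Tendsto (fun k => eLpNorm ((∑ i, fun x => ‖f k i x - g i x‖) - 0) p μ)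
      Filter.atTop (nhds 0) := by
    have hs : Filter.Tendsto (fun k => ∑ i, eLpNorm (f k i - g i) p μ) Filter.atTop (nhds 0) := by
      have := tendsto_finsetSum Finset.univ fun i _ => h i
      simpa using this
    refine tendsto_of_tendsto_of_tendsto_of_le_of_le tendsto_const_nhds hs
      (fun _ => zero_le) fun k => ?_
    rw [sub_zero]
    refine (eLpNorm_sum_le (fun i _ => ((hf k i).sub (hg i)).norm) hp).trans (le_of_eq ?_)
    exact Finset.sum_congr rfl fun i _ => eLpNorm_norm (f k i - g i)
  obtain ⟨σ, hσ, hae⟩ := (tendstoInMeasure_of_tendsto_eLpNorm (zero_lt_one.trans_le hp).ne' hF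
    aestronglyMeasurable_zero hlim).exists_seq_tendsto_ae
  refine ⟨σ, hσ, ?_⟩
  filter_upwards [hae] with x hx i
  rw [tendsto_iff_norm_sub_tendsto_zero]
  refine tendsto_of_tendsto_of_tendsto_of_le_of_le tendsto_const_nhds hx
    (fun _ => norm_nonneg _) fun k => ?_
  rw [Finset.sum_apply]
  exact Finset.single_le_sum (f := fun i => ‖f (σ k) i x - g i x‖) (fun _ _ => norm_nonneg _)
    (Finset.mem_univ i)

end Compactness

/-! ### Convex combinations of tails. -/

section TailWeights

/-- Finitely supported convex weights on the integers `≥ k`. -/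
structure IsTailWeight (k : ℕ) (θ : ℕ →₀ ℝ) : Prop where
  nonneg : ∀ j, 0 ≤ θ j
  eq_zero : ∀ j < k, θ j = 0
  sum_eq_one : ∑ j ∈ θ.support, θ j = 1

theorem IsTailWeight.le_of_mem_support {k : ℕ} {θ : ℕ →₀ ℝ} (hθ : IsTailWeight k θ) {j : ℕ}
    (hj : j ∈ θ.support) : k ≤ j := by
  by_contra h
  exact Finsupp.mem_support_iff.1 hj (hθ.eq_zero j (not_le.1 h))

theorem isTailWeight_single (k : ℕ) : IsTailWeight k (Finsupp.single k 1) :=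
  ⟨fun j => by rw [Finsupp.single_apply]; split_ifs <;> norm_num,
    fun j hj => Finsupp.single_eq_of_ne hj.ne,
    by rw [Finsupp.support_single _ one_ne_zero]; simp⟩

theorem linearCombination_one_eq (θ : ℕ →₀ ℝ) :
    Finsupp.linearCombination ℝ (fun _ : ℕ => (1 : ℝ)) θ = ∑ j ∈ θ.support, θ j := by
  simp [Finsupp.linearCombination_apply, Finsupp.sum]

/-- Makes the midpoint of two almost minimal combinations a competitor, as the parallelogram law
requires. -/
theorem IsTailWeight.midpoint {k l : ℕ} (hkl : k ≤ l) {θ η : ℕ →₀ ℝ} (hθ : IsTailWeight k θ)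
    (hη : IsTailWeight l η) : IsTailWeight k ((1 / 2 : ℝ) • (θ + η)) := by
  refine ⟨fun j => ?_, fun j hj => ?_, ?_⟩
  · have := hθ.1 j
    have := hη.1 j
    simp only [Finsupp.smul_apply, Finsupp.add_apply, smul_eq_mul]
    positivity
  · simp [hθ.2 j hj, hη.2 j (hj.trans_le hkl)]
  · rw [← linearCombination_one_eq, map_smul, map_add, linearCombination_one_eq,
      linearCombination_one_eq, hθ.3, hη.3]
    norm_num

theorem IsTailWeight.mono {k l : ℕ} (hkl : k ≤ l) {θ : ℕ →₀ ℝ} (hθ : IsTailWeight l θ) :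
    IsTailWeight k θ :=
  ⟨hθ.1, fun j hj => hθ.2 j (hj.trans_le hkl), hθ.3⟩

theorem IsTailWeight.norm_sum_le {k : ℕ} {θ : ℕ →₀ ℝ} (hθ : IsTailWeight k θ) {a : ℕ → ℝ} {C : ℝ}
    (h : ∀ j, k ≤ j → ‖a j‖ ≤ C) : ‖∑ j ∈ θ.support, θ j * a j‖ ≤ C := by
  calc ‖∑ j ∈ θ.support, θ j * a j‖ ≤ ∑ j ∈ θ.support, θ j * C := by
        refine (_root_.norm_sum_le _ _).trans (Finset.sum_le_sum fun j hj => ?_)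
        rw [norm_mul, Real.norm_of_nonneg (hθ.1 j)]
        exact mul_le_mul_of_nonneg_left (h j (hθ.le_of_mem_support hj)) (hθ.1 j)
    _ = C := by rw [← Finset.sum_mul, hθ.3, one_mul]

theorem IsTailWeight.eLpNorm_sum_le {X : Type*} [MeasurableSpace X] {μ : Measure X} {p : ℝ≥0∞}
    (hp : 1 ≤ p) {k : ℕ} {θ : ℕ →₀ ℝ} (hθ : IsTailWeight k θ) {f : ℕ → X → ℝ} {C : ℝ≥0∞}
    (hf : ∀ j, AEStronglyMeasurable (f j) μ) (h : ∀ j, k ≤ j → eLpNorm (f j) p μ ≤ C) :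
    eLpNorm (∑ j ∈ θ.support, θ j • f j) p μ ≤ C := by
  calc eLpNorm (∑ j ∈ θ.support, θ j • f j) p μ
      ≤ ∑ j ∈ θ.support, eLpNorm (θ j • f j) p μ :=
        MeasureTheory.eLpNorm_sum_le (fun j _ => (hf j).const_smul _) hp
    _ ≤ ∑ j ∈ θ.support, ENNReal.ofReal (θ j) * C := by
        refine Finset.sum_le_sum fun j hj => ?_
        rw [eLpNorm_const_smul, Real.enorm_eq_ofReal (hθ.1 j)]
        gcongr
        exact h j (hθ.le_of_mem_support hj)
    _ = C := by
        rw [← Finset.sum_mul, ← ENNReal.ofReal_sum_of_nonneg (fun j _ => hθ.1 j), hθ.3,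
          ENNReal.ofReal_one, one_mul]

/-- Weights supported on `j ≥ k` with total mass one see only the late terms. This lets the
nonlinear term be averaged without losing its limit. -/
theorem tendsto_tailAverage {θ : ℕ → ℕ →₀ ℝ} (hθ : ∀ k, IsTailWeight k (θ k)) {a : ℕ → ℝ} {l : ℝ}
    (ha : Filter.Tendsto a Filter.atTop (nhds l)) :
    Filter.Tendsto (fun k => ∑ j ∈ (θ k).support, θ k j * a j) Filter.atTop (nhds l) := by
  rw [Metric.tendsto_atTop] at ha ⊢
  intro ε hε
  obtain ⟨N, hN⟩ := ha (ε / 2) (half_pos hε)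
  refine ⟨N, fun k hk => ?_⟩
  have h1 : ∑ j ∈ (θ k).support, θ k j * a j - l
      = ∑ j ∈ (θ k).support, θ k j * (a j - l) := by
    simp only [mul_sub, Finset.sum_sub_distrib, ← Finset.sum_mul, (hθ k).3, one_mul]
  rw [dist_eq_norm, h1]
  refine lt_of_le_of_lt ((hθ k).norm_sum_le fun j hj => ?_) (half_lt_self hε)
  rw [← dist_eq_norm]
  exact (hN j (hk.trans hj)).le

theorem tendsto_eLpNorm_tailAverage {X : Type*} [MeasurableSpace X] {μ : Measure X} {p : ℝ≥0∞}
    (hp : 1 ≤ p) {θ : ℕ → ℕ →₀ ℝ} (hθ : ∀ k, IsTailWeight k (θ k)) {f : ℕ → X → ℝ}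
    (hf : ∀ j, AEStronglyMeasurable (f j) μ)
    (h : Filter.Tendsto (fun j => eLpNorm (f j) p μ) Filter.atTop (nhds 0)) :
    Filter.Tendsto (fun k => eLpNorm (∑ j ∈ (θ k).support, θ k j • f j) p μ) Filter.atTop
      (nhds 0) := by
  rw [ENNReal.tendsto_nhds_zero] at h ⊢
  intro ε hε
  obtain ⟨N, hN⟩ := Filter.eventually_atTop.1 (h ε hε)
  filter_upwards [Filter.eventually_ge_atTop N] with k hk
  exact (hθ k).eLpNorm_sum_le hp hf fun j hj => hN j (hk.trans hj)

/-- In a Hilbert space, suitable convex combinations of the tails of a bounded sequence converge. -/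
theorem exists_tailWeight_tendsto {H : Type*} [NormedAddCommGroup H] [InnerProductSpace ℝ H]
    [CompleteSpace H] {x : ℕ → H} {M : ℝ} (hx : ∀ k, ‖x k‖ ≤ M) :
    ∃ (θ : ℕ → ℕ →₀ ℝ) (y : H), (∀ k, IsTailWeight k (θ k)) ∧
      Filter.Tendsto (fun k => ∑ j ∈ (θ k).support, θ k j • x j) Filter.atTop (nhds y) := by
  set T := Finsupp.linearCombination ℝ x with hT
  -- The squared distance from the origin to the convex hull of the `k`-th tail. It increases with
  -- `k` as the tails shrink, and is bounded by `M ^ 2`.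
  set d : ℕ → ℝ := fun k => sInf ((fun θ => ‖T θ‖ ^ 2) '' {θ | IsTailWeight k θ}) with hd
  have hbdd : ∀ k, BddBelow ((fun θ => ‖T θ‖ ^ 2) '' {θ | IsTailWeight k θ}) := fun k =>
    ⟨0, by rintro _ ⟨θ, -, rfl⟩; positivity⟩
  have hne : ∀ k, ((fun θ => ‖T θ‖ ^ 2) '' {θ | IsTailWeight k θ}).Nonempty := fun k =>
    ⟨_, _, isTailWeight_single k, rfl⟩
  have hdle : ∀ k θ, IsTailWeight k θ → d k ≤ ‖T θ‖ ^ 2 := fun k θ hθ =>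
    csInf_le (hbdd k) ⟨θ, hθ, rfl⟩
  have hmono : Monotone d := fun k l hkl =>
    csInf_le_csInf (hbdd k) (hne l) (image_mono fun θ hθ => IsTailWeight.mono hkl hθ)
  have hub : BddAbove (range d) := by
    refine ⟨M ^ 2, ?_⟩
    rintro _ ⟨k, rfl⟩
    refine (hdle k _ (isTailWeight_single k)).trans ?_
    rw [hT, Finsupp.linearCombination_single, one_smul]
    exact pow_le_pow_left₀ (norm_nonneg _) (hx k) 2
  have hlim := tendsto_atTop_ciSup hmono hub
  set L := ⨆ k, d k with hL
  have hdL : ∀ k, d k ≤ L := fun k => le_ciSup hub k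
  have hex : ∀ k : ℕ, ∃ θ, IsTailWeight k θ ∧ ‖T θ‖ ^ 2 < d k + 1 / ((k : ℝ) + 1) := by
    intro k
    obtain ⟨_, ⟨θ, hθ, rfl⟩, hlt⟩ := exists_lt_of_csInf_lt (hne k)
      (show d k < d k + 1 / ((k : ℝ) + 1) from lt_add_of_pos_right _ (by positivity))
    exact ⟨θ, hθ, hlt⟩
  choose θ hθ hlt using hex
  have hcauchy : CauchySeq fun k => T (θ k) := by
    rw [Metric.cauchySeq_iff']
    intro ε hε
    have h0 : Filter.Tendsto (fun k : ℕ => 2 * (L - d k) + 4 * (1 / ((k : ℝ) + 1)))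
        Filter.atTop (nhds 0) := by
      have := ((hlim.const_sub L).const_mul 2).add
        (tendsto_one_div_add_atTop_nhds_zero_nat.const_mul (4 : ℝ))
      simpa using this
    obtain ⟨N, hN⟩ := (h0.eventually (gt_mem_nhds (by positivity : 0 < ε ^ 2))).exists
    refine ⟨N, fun k hk => ?_⟩
    -- The midpoint is admissible for the tail from `N`, so its squared norm is at least `d N`. The
    -- parallelogram law then bounds the squared distance by `2 * (d k - d N)` plus `4 / (N + 1)`,
    -- and `d k ≤ L`.
    have h1 := parallelogram_law_with_norm ℝ (T (θ k)) (T (θ N))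
    have h2 := hdle N _ ((hθ N).midpoint hk (hθ k))
    rw [map_smul, map_add, norm_smul, mul_pow, add_comm (T (θ N))] at h2
    have h3 := hlt k
    have h4 := hlt N
    have h5 : 1 / ((k : ℝ) + 1) ≤ 1 / ((N : ℝ) + 1) :=
      one_div_le_one_div_of_le (by positivity) (by simpa using hk)
    have h6 := hdL k
    rw [dist_eq_norm]
    refine lt_of_pow_lt_pow_left₀ 2 hε.le ?_
    norm_num at h2
    nlinarith
  obtain ⟨y, hy⟩ := cauchySeq_tendsto_of_complete hcauchy
  refine ⟨θ, y, hθ, ?_⟩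
  simpa only [hT, Finsupp.linearCombination_apply, Finsupp.sum] using hy

end TailWeights


/-! ### Limits of bounded sequences of jets. -/

section LimitJets

variable {n : ℕ} {Ω : Set (Euc n)}

/-- Suitable convex combinations of the tails of a bounded sequence of finite families in `L²`
converge in `L²`. -/
theorem exists_tailWeight_tendsto_eLpNorm {X ι : Type*} [MeasurableSpace X] [Fintype ι]
    {μ : Measure X} {f : ℕ → ι → X → ℝ} (hf : ∀ k i, MemLp (f k i) 2 μ) {M : ℝ≥0}
    (hM : ∀ k i, eLpNorm (f k i) 2 μ ≤ M) :
    ∃ (θ : ℕ → ℕ →₀ ℝ) (g : ι → X → ℝ), (∀ k, IsTailWeight k (θ k)) ∧ (∀ i, MemLp (g i) 2 μ) ∧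
      ∀ i, Filter.Tendsto (fun k => eLpNorm (∑ j ∈ (θ k).support, θ k j • f j i - g i) 2 μ)
        Filter.atTop (nhds 0) := by
  -- The Hilbert sum of the copies of `L²` provides the same weights for all components.
  let x : ℕ → PiLp 2 (fun _ : ι => Lp ℝ 2 μ) := fun k =>
    WithLp.toLp 2 fun i => (hf k i).toLp (f k i)
  have hx : ∀ k, ‖x k‖ ≤ Real.sqrt (∑ _i : ι, (M : ℝ) ^ 2) := by
    intro k
    rw [PiLp.norm_eq_of_L2]
    refine Real.sqrt_le_sqrt (Finset.sum_le_sum fun i _ => ?_)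
    refine pow_le_pow_left₀ (norm_nonneg _) ?_ 2
    change ‖(hf k i).toLp (f k i)‖ ≤ M
    rw [Lp.norm_toLp]
    exact ENNReal.toReal_le_of_le_ofReal M.2 (by simpa using hM k i)
  obtain ⟨θ, y, hθ, hy⟩ := exists_tailWeight_tendsto hx
  refine ⟨θ, fun i => y i, hθ, fun i => Lp.memLp (y i), fun i => ?_⟩
  have h1 : Filter.Tendsto (fun k => (∑ j ∈ (θ k).support, θ k j • x j) i) Filter.atTop
      (nhds (y i)) := ((PiLp.continuous_apply 2 (fun _ : ι => Lp ℝ 2 μ) i).tendsto y).comp hy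
  rw [Lp.tendsto_Lp_iff_tendsto_eLpNorm'] at h1
  refine h1.congr fun k => eLpNorm_congr_ae ?_
  have h2 : (∑ j ∈ (θ k).support, θ k j • x j) i
      = ∑ j ∈ (θ k).support, θ k j • (hf j i).toLp (f j i) := by
    simp [x]
  rw [h2]
  have h3 : ∀ᵐ z ∂μ, ∀ j ∈ (θ k).support,
      (θ k j • (hf j i).toLp (f j i) : Lp ℝ 2 μ) z = θ k j • f j i z := by
    refine (Finset.eventually_all _).2 fun j _ => ?_
    filter_upwards [Lp.coeFn_smul (θ k j) ((hf j i).toLp (f j i)), (hf j i).coeFn_toLp]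
      with z h4 h5
    rw [h4, Pi.smul_apply, h5]
  filter_upwards [Lp.coeFn_finsetSum (θ k).support
    (fun j => θ k j • (hf j i).toLp (f j i)), h3] with z h4 h5
  rw [Pi.sub_apply, Pi.sub_apply, h4, Finset.sum_apply, Finset.sum_apply]
  congr 1
  exact Finset.sum_congr rfl fun j hj => h5 j hj

theorem tendsto_eLpNorm_one {X : Type*} [MeasurableSpace X] {μ : Measure X} [IsFiniteMeasure μ]
    {f : ℕ → X → ℝ} (hf : ∀ k, AEStronglyMeasurable (f k) μ)
    (h : Filter.Tendsto (fun k => eLpNorm (f k) 2 μ) Filter.atTop (nhds 0)) :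
    Filter.Tendsto (fun k => eLpNorm (f k) 1 μ) Filter.atTop (nhds 0) := by
  have hc : μ univ ^ (1 / (1 : ℝ≥0∞).toReal - 1 / (2 : ℝ≥0∞).toReal) ≠ ⊤ :=
    ENNReal.rpow_ne_top_of_nonneg (by norm_num) (measure_ne_top _ _)
  have h2 := ENNReal.Tendsto.mul_const h (Or.inr hc)
  rw [zero_mul] at h2
  exact tendsto_of_tendsto_of_tendsto_of_le_of_le tendsto_const_nhds h2 (fun _ => zero_le)
    fun k => eLpNorm_le_eLpNorm_mul_rpow_measure_univ (by norm_num) (hf k)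

theorem IsWeakJet.of_tendsto {K : ℕ → Jet n} {J : Jet n} (hK : ∀ k, IsWeakJet Ω (K k))
    (hJ : ∀ a, LocallyIntegrableOn (J a) Ω)
    (h : ∀ a, Filter.Tendsto (fun k => eLpNorm (K k a - J a) 1 (volume.restrict Ω)) Filter.atTop
      (nhds 0)) : IsWeakJet Ω J :=
  ⟨fun _ => .of_tendsto (fun k => (hK k).1 _) (hJ _) (hJ _) (h _) (h _),
    fun _ _ => .of_tendsto (fun k => (hK k).2 _ _) (hJ _) (hJ _) (h _) (h _)⟩

/-- `W_0^{2,p}` is closed under limits of convex combinations. -/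
theorem memW2Zero_of_tendsto_tailAverage (hΩ : IsOpen Ω) {p : ℝ≥0∞} (hp : 1 ≤ p)
    {w : ℕ → Euc n → ℝ} (hw : ∀ k, MemW2Zero Ω p (w k)) {θ : ℕ → ℕ →₀ ℝ}
    (hθ : ∀ k, IsTailWeight k (θ k)) {J : Jet n} (hJ : IsWeakJet Ω J)
    (hJp : ∀ a, MemLp (J a) p (volume.restrict Ω))
    (h : ∀ a, Filter.Tendsto (fun k => eLpNorm (∑ j ∈ (θ k).support, θ k j • weakJet Ω (w j) a
      - J a) p (volume.restrict Ω)) Filter.atTop (nhds 0)) : MemW2Zero Ω p (J none) := by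
  refine ⟨hJ.memW2 hJp, fun ε hε => ?_⟩
  have hinv : Filter.Tendsto (fun k : ℕ => ((k : ℝ≥0∞))⁻¹) Filter.atTop (nhds 0) :=
    ENNReal.tendsto_inv_nat_nhds_zero
  choose φ hφ hlt using fun k : ℕ => (hw k).2 ((k : ℝ≥0∞)⁻¹) (by simp)
  have hwJ := fun k => (hw k).1.isWeakJet hΩ
  have hm : ∀ j a, AEStronglyMeasurable (weakJet Ω (w j) a) (volume.restrict Ω) := fun j a =>
    ((hw j).1.memLp hΩ (hwJ j) rfl a).1
  have hmd : ∀ j a, AEStronglyMeasurable (weakJet Ω (w j) a - classicalJet (φ j) a)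
      (volume.restrict Ω) := fun j a =>
    (hm j a).sub (continuous_classicalJet (hφ j).contDiff a).aestronglyMeasurable
  have hd : ∀ a, Filter.Tendsto (fun k => eLpNorm (weakJet Ω (w k) a - classicalJet (φ k) a) p
      (volume.restrict Ω)) Filter.atTop (nhds 0) := fun a => by
    refine tendsto_of_tendsto_of_tendsto_of_le_of_le tendsto_const_nhds hinv
      (fun _ => zero_le) fun k => ?_
    exact (eLpNorm_le_jetNorm p (weakJet Ω (w k) - classicalJet (φ k)) a).trans
      ((normW2_sub_eq hΩ (hwJ k) (hφ k).contDiff p).symm.le.trans (hlt k).le)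
  have hsum : Filter.Tendsto (fun k => ∑ a, (eLpNorm (∑ j ∈ (θ k).support,
      θ k j • weakJet Ω (w j) a - J a) p (volume.restrict Ω)
      + eLpNorm (∑ j ∈ (θ k).support, θ k j • (weakJet Ω (w j) a - classicalJet (φ j) a)) p
        (volume.restrict Ω))) Filter.atTop (nhds 0) := by
    have := tendsto_finsetSum Finset.univ fun a (_ : a ∈ Finset.univ) =>
      (h a).add (tendsto_eLpNorm_tailAverage hp hθ (hmd · a) (hd a))
    simpa using this
  obtain ⟨k, hk⟩ := (hsum.eventually (gt_mem_nhds hε)).exists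
  -- The limit is approximated by the same convex combination of the test functions `φ j`. The error
  -- splits into the distance of the combination of the `w j` from `J` and the tail average of the
  -- errors `w j - φ j`.
  set K : Jet n := J - ∑ j ∈ (θ k).support, θ k j • classicalJet (φ j) with hK
  have hKJ : IsWeakJet Ω K := hJ.sub (isWeakJet_sum _ fun j _ =>
    (isWeakJet_classicalJet (hφ j).contDiff).const_smul _)
  have hKn : K none = J none - ∑ j ∈ (θ k).support, θ k j • φ j := by
    simp [hK, Finset.sum_apply, classicalJet]
  refine ⟨∑ j ∈ (θ k).support, θ k j • φ j,
    isTestFunction_sum _ fun j _ => (hφ j).const_smul _, lt_of_le_of_lt ?_ hk⟩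
  rw [← hKn, hKJ.normW2_eq hΩ]
  refine Finset.sum_le_sum fun a _ => ?_
  have hs1 : AEStronglyMeasurable (∑ j ∈ (θ k).support, θ k j • weakJet Ω (w j) a - J a)
      (volume.restrict Ω) :=
    (Finset.aestronglyMeasurable_sum _ fun j _ => (hm j a).const_smul _).sub (hJp a).1
  have hs2 : AEStronglyMeasurable (∑ j ∈ (θ k).support,
      θ k j • (weakJet Ω (w j) a - classicalJet (φ j) a)) (volume.restrict Ω) :=
    Finset.aestronglyMeasurable_sum _ fun j _ => (hmd j a).const_smul _
  have heq : K a = -(∑ j ∈ (θ k).support, θ k j • weakJet Ω (w j) a - J a)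
      + ∑ j ∈ (θ k).support, θ k j • (weakJet Ω (w j) a - classicalJet (φ j) a) := by
    simp only [hK, Pi.sub_apply, Finset.sum_apply, Pi.smul_apply, smul_sub,
      Finset.sum_sub_distrib]
    abel
  rw [heq]
  exact (eLpNorm_add_le hs1.neg hs2 hp).trans (by rw [eLpNorm_neg])

/-- Rellich-type compactness: a bounded sequence in `W_0^{2,p}`, `p > n`, has a subsequence
whose values and gradients converge almost everywhere. -/
theorem exists_subseq_gradient_tendsto (hΩ : IsBoundedLipschitzDomain Ω) {p : ℝ≥0} (hp : 1 ≤ p)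
    (hnp : (n : ℝ≥0) < p) {w : ℕ → Euc n → ℝ} (hw : ∀ k, MemW2Zero Ω p (w k)) {M : ℝ≥0}
    (hM : ∀ k a, eLpNorm (weakJet Ω (w k) a) p (volume.restrict Ω) ≤ M) :
    ∃ (f : Option (Fin n) → Euc n → ℝ) (σ : ℕ → ℕ), StrictMono σ ∧
      ∀ᵐ x ∂(volume.restrict Ω), ∀ b : Option (Fin n),
        Filter.Tendsto (fun k => weakJet Ω (w (σ k)) (b.map Sum.inl) x) Filter.atTop
          (nhds (f b x)) := by
  have : IsFiniteMeasure (volume.restrict Ω) := ⟨by simpa using hΩ.volume_ne_top.lt_top⟩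
  have hp' : (1 : ℝ≥0∞) ≤ p := by exact_mod_cast hp
  have hmem : ∀ᵐ x ∂(volume.restrict Ω), x ∈ closure Ω := by
    filter_upwards [ae_restrict_mem hΩ.isOpen.measurableSet] with x hx using subset_closure hx
  have hinv : Filter.Tendsto (fun k : ℕ => ((k : ℝ≥0∞) + 1)⁻¹) Filter.atTop (nhds 0) := by
    have := ENNReal.tendsto_inv_nat_nhds_zero.comp (Filter.tendsto_add_atTop_nat 1)
    refine this.congr fun k => ?_
    simp
  -- The shifted index makes every tolerance at most one, so the test functions are uniformly
  -- bounded from the first on.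
  choose φ hφ hlt using fun k : ℕ => (hw k).2 (((k : ℝ≥0∞) + 1)⁻¹)
    (by simp [ENNReal.add_eq_top])
  have hwJ := fun k => (hw k).1.isWeakJet hΩ.isOpen
  have hm : ∀ k a, AEStronglyMeasurable (weakJet Ω (w k) a) (volume.restrict Ω) := fun j a =>
    ((hw j).1.memLp hΩ.isOpen (hwJ j) rfl a).1
  have hcont := fun k => continuous_classicalJet (hφ k).contDiff
  have hdle : ∀ k a, eLpNorm (weakJet Ω (w k) a - classicalJet (φ k) a) p
      (volume.restrict Ω) ≤ ((k : ℝ≥0∞) + 1)⁻¹ := fun k a =>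
    (eLpNorm_le_jetNorm p (weakJet Ω (w k) - classicalJet (φ k)) a).trans
      ((normW2_sub_eq hΩ.isOpen (hwJ k) (hφ k).contDiff p).symm.le.trans (hlt k).le)
  have hbound : ∀ k a, eLpNorm (classicalJet (φ k) a) p volume ≤ (M : ℝ≥0∞) + 1 := by
    intro k a
    rw [← eLpNorm_restrict_eq_of_support_subset (s := Ω) (f := classicalJet (φ k) a) fun x hx => by
      by_contra hxΩ
      exact hx (classicalJet_eq_zero (fun h => hxΩ ((hφ k).tsupport_subset h)) a)]
    have heq : classicalJet (φ k) a
        = weakJet Ω (w k) a - (weakJet Ω (w k) a - classicalJet (φ k) a) := by abel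
    rw [heq]
    refine (eLpNorm_sub_le (hm k a) ((hm k a).sub (hcont k a).aestronglyMeasurable) hp').trans
      (add_le_add (hM k a) ((hdle k a).trans ?_))
    rw [ENNReal.inv_le_one]
    exact le_add_self
  -- Values and first derivatives of the test functions. Their gradients involve derivatives of
  -- order at most two, so the `W^{2,p}` bound gives equicontinuity of all of them.
  let ψ : ℕ → Option (Fin n) → Euc n → ℝ := fun k b => classicalJet (φ k) (b.map Sum.inl)
  have hψ : ∀ k b, ContDiff ℝ 1 (ψ k b) := by
    intro k b
    match b with
    | none => exact (hφ k).contDiff.of_le (by simp)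
    | some i => exact (contDiff_classicalPartial (hφ k).contDiff i).of_le (by simp)
  have hfd : ∀ k b, eLpNorm (fderiv ℝ (ψ k b)) p volume ≤ ((n * (M + 1) : ℝ≥0) : ℝ≥0∞) := by
    intro k b
    refine (eLpNorm_fderiv_le_sum (hψ k b) hp _).trans ?_
    have h1 : ∀ i, eLpNorm (classicalPartial i (ψ k b)) p volume ≤ (M : ℝ≥0∞) + 1 := by
      intro i
      match b with
      | none => exact hbound k (some (.inl i))
      | some j => exact hbound k (some (.inr (j, i)))
    refine (Finset.sum_le_sum fun i _ => h1 i).trans (le_of_eq ?_)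
    simp [mul_add]
  obtain ⟨f, σ, hσ, hf⟩ := exists_subseq_tendstoUniformlyOn (M := (n + 1) * (M + 1)) hp hnp
    hΩ.isCompact_closure hψ (fun k b => (hbound k _).trans (by
      have h1 : M + 1 ≤ ((n : ℝ≥0) + 1) * (M + 1) := le_mul_of_one_le_left zero_le (by simp)
      exact_mod_cast h1)) (fun k b => (hfd k b).trans (by
      have h1 : (n : ℝ≥0) * (M + 1) ≤ ((n : ℝ≥0) + 1) * (M + 1) := by gcongr; simp
      exact_mod_cast h1))
  have hfm : ∀ b, AEStronglyMeasurable (f b) (volume.restrict Ω) := fun b =>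
    aestronglyMeasurable_of_tendsto_ae Filter.atTop
      (fun k => (hψ (σ k) b).continuous.aestronglyMeasurable) (by
        filter_upwards [hmem] with x hx using (hf b).tendsto_at hx)
  -- The `L^p` distance between `w k` and `φ k` tends to zero, so the uniform limits of the test
  -- functions are also the `L^p` limits for `w`.
  have hconv : ∀ b : Option (Fin n), Filter.Tendsto (fun k =>
      eLpNorm (weakJet Ω (w (σ k)) (b.map Sum.inl) - f b) p (volume.restrict Ω)) Filter.atTop
      (nhds 0) := by
    intro b
    have h1 := tendsto_eLpNorm_of_tendstoUniformlyOn hmem (hf b) p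
    have h2 := h1.add (hinv.comp hσ.tendsto_atTop)
    rw [add_zero] at h2
    refine tendsto_of_tendsto_of_tendsto_of_le_of_le tendsto_const_nhds h2
      (fun _ => zero_le) fun k => ?_
    have heq : weakJet Ω (w (σ k)) (b.map Sum.inl) - f b = (ψ (σ k) b - f b)
        + (weakJet Ω (w (σ k)) (b.map Sum.inl) - classicalJet (φ (σ k)) (b.map Sum.inl)) := by
      simp only [ψ]
      abel
    simp only [heq]
    exact (eLpNorm_add_le ((hψ (σ k) b).continuous.aestronglyMeasurable.sub (hfm b))
      ((hm _ _).sub (hcont _ _).aestronglyMeasurable) hp').trans (add_le_add le_rfl (hdle _ _))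
  obtain ⟨τ, hτ, hae⟩ := exists_subseq_ae_tendsto hp'
    (f := fun k (b : Option (Fin n)) => weakJet Ω (w (σ k)) (b.map Sum.inl))
    (fun k b => hm _ _) hfm hconv
  exact ⟨f, σ ∘ τ, hσ.comp hτ, hae⟩

/-- Compactness in `⋂ W^{2,q} ∩ W_0^{2,2}`: values and gradients of a subsequence converge almost
everywhere, and convex combinations of its tails converge with all second derivatives. -/
theorem exists_limit_jet (hΩ : IsBoundedLipschitzDomain Ω) {w : ℕ → Euc n → ℝ}
    (hw : ∀ k, MemW2Zero Ω 2 (w k)) (hwq : ∀ k, ∀ q : ℝ≥0, 1 < q → MemW2 Ω q (w k)) {p₀ : ℝ≥0}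
    (hM : ∀ p : ℝ≥0, p₀ ≤ p → ∃ M : ℝ≥0, ∀ k a,
      eLpNorm (weakJet Ω (w k) a) p (volume.restrict Ω) ≤ M) :
    ∃ (J : Jet n) (σ : ℕ → ℕ) (θ : ℕ → ℕ →₀ ℝ), StrictMono σ ∧ (∀ k, IsTailWeight k (θ k)) ∧
      IsWeakJet Ω J ∧ MemW2Zero Ω 2 (J none) ∧ (∀ q : ℝ≥0, 1 < q → MemW2 Ω q (J none)) ∧
      (∀ᵐ x ∂(volume.restrict Ω), ∀ b : Option (Fin n),
        Filter.Tendsto (fun k => weakJet Ω (w (σ k)) (b.map Sum.inl) x) Filter.atTop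
          (nhds (J (b.map Sum.inl) x))) ∧
      ∀ᵐ x ∂(volume.restrict Ω), ∀ a, Filter.Tendsto
        (fun k => ∑ j ∈ (θ k).support, θ k j * weakJet Ω (w (σ j)) a x) Filter.atTop
          (nhds (J a x)) := by
  have : IsFiniteMeasure (volume.restrict Ω) := ⟨by simpa using hΩ.volume_ne_top.lt_top⟩
  have hwJ := fun k => (hw k).1.isWeakJet hΩ.isOpen
  have hL2 : ∀ k a, MemLp (weakJet Ω (w k) a) 2 (volume.restrict Ω) := fun k a =>
    (hw k).1.memLp hΩ.isOpen (hwJ k) rfl a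
  -- Large enough for the given bounds, for Morrey's inequality (`p > n`), and for bounds in `L²`
  -- (`p ≥ 2`).
  set p : ℝ≥0 := max p₀ (n + 2) with hp
  have hp2 : (2 : ℝ≥0) ≤ p := le_max_of_le_right (by simp)
  have hp1 : (1 : ℝ≥0) < p := lt_of_lt_of_le (by norm_num) hp2
  have hnp : (n : ℝ≥0) < p := lt_of_lt_of_le (by simp) (le_max_right _ _)
  obtain ⟨M, hMp⟩ := hM p (le_max_left _ _)
  obtain ⟨f, σ, hσ, hf⟩ := exists_subseq_gradient_tendsto hΩ hp1.le hnp
    (fun k => (hw k).of_memW2 hΩ hp1.le (by norm_num) (hwq k p hp1)) hMp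
  have hM2 : ∃ M₂ : ℝ≥0, ∀ k a, eLpNorm (weakJet Ω (w k) a) 2 (volume.restrict Ω) ≤ M₂ := by
    set c : ℝ≥0∞ := (volume.restrict Ω) univ ^ (1 / (2 : ℝ≥0∞).toReal - 1 / (p : ℝ≥0∞).toReal)
      with hc
    have hct : c ≠ ⊤ := by
      refine ENNReal.rpow_ne_top_of_nonneg ?_ (measure_ne_top _ _)
      have h2 : (2 : ℝ) ≤ p := by exact_mod_cast hp2
      rw [ENNReal.toReal_ofNat, ENNReal.coe_toReal, sub_nonneg]
      exact one_div_le_one_div_of_le two_pos h2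
    refine ⟨(M * c).toNNReal, fun k a => ?_⟩
    rw [ENNReal.coe_toNNReal (ENNReal.mul_ne_top ENNReal.coe_ne_top hct)]
    refine (eLpNorm_le_eLpNorm_mul_rpow_measure_univ (q := p) (by exact_mod_cast hp2)
      (hL2 k a).1).trans ?_
    gcongr
    exact hMp k a
  obtain ⟨M₂, hM₂⟩ := hM2
  obtain ⟨θ, J, hθ, hJ2, hJlim⟩ := exists_tailWeight_tendsto_eLpNorm
    (f := fun k => weakJet Ω (w (σ k))) (fun k a => hL2 _ a) (fun k a => hM₂ _ a)
  have hKm : ∀ k a, AEStronglyMeasurable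
      (∑ j ∈ (θ k).support, θ k j • weakJet Ω (w (σ j)) a) (volume.restrict Ω) := fun k a =>
    Finset.aestronglyMeasurable_sum _ fun j _ => (hL2 _ a).1.const_smul _
  have hJJ : IsWeakJet Ω J := by
    refine IsWeakJet.of_tendsto
      (K := fun k => ∑ j ∈ (θ k).support, θ k j • weakJet Ω (w (σ j)))
      (fun k => isWeakJet_sum _ fun j _ => (hwJ _).const_smul _)
      (fun a => (show IntegrableOn (J a) Ω volume from
        (hJ2 a).integrable (by norm_num)).locallyIntegrableOn) fun a => ?_
    simp only [Finset.sum_apply, Pi.smul_apply]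
    exact tendsto_eLpNorm_one (fun k => (hKm k a).sub (hJ2 a).1) (hJlim a)
  obtain ⟨τ, hτ, hae⟩ := exists_subseq_ae_tendsto (p := 2) (by norm_num)
    (f := fun k a => ∑ j ∈ (θ k).support, θ k j • weakJet Ω (w (σ j)) a) hKm
    (fun a => (hJ2 a).1) hJlim
  -- Since `k ≤ τ k`, the weights remain tail weights at level `k` along the subsequence.
  have hθτ : ∀ k, IsTailWeight k (θ (τ k)) := fun k => (hθ (τ k)).mono (hτ.le_apply)
  have hae' : ∀ᵐ x ∂(volume.restrict Ω), ∀ a, Filter.Tendsto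
      (fun k => ∑ j ∈ (θ (τ k)).support, θ (τ k) j * weakJet Ω (w (σ j)) a x) Filter.atTop
        (nhds (J a x)) := by
    filter_upwards [hae] with x hx a
    refine (hx a).congr fun k => ?_
    simp [Finset.sum_apply]
  refine ⟨J, σ, fun k => θ (τ k), hσ, hθτ, hJJ, ?_, ?_, ?_, hae'⟩
  · exact memW2Zero_of_tendsto_tailAverage hΩ.isOpen (by norm_num) (fun k => hw (σ k)) hθ hJJ hJ2
      hJlim
  · intro q _
    set r : ℝ≥0 := max q p with hr
    obtain ⟨Mr, hMr⟩ := hM r ((le_max_left _ _).trans (le_max_right _ _))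
    have hr1 : (1 : ℝ≥0∞) ≤ r := by exact_mod_cast hp1.le.trans (le_max_right _ _)
    have hJr : MemW2 Ω r (J none) := by
      -- Fatou's lemma: the combinations converge almost everywhere and their `L^r` norms are at
      -- most `Mr`.
      refine hJJ.memW2 fun a => ⟨(hJ2 a).1, lt_of_le_of_lt ?_ (ENNReal.coe_lt_top (r := Mr))⟩
      refine (Lp.eLpNorm_lim_le_liminf_eLpNorm (fun k => hKm (τ k) a) (J a)
        (by filter_upwards [hae] with x hx using hx a)).trans ?_
      refine Filter.liminf_le_of_le (by isBoundedDefault) fun b hb => ?_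
      obtain ⟨k, hk⟩ := hb.exists
      exact hk.trans ((hθ (τ k)).eLpNorm_sum_le hr1 (fun j => (hL2 _ a).1)
        fun j _ => hMr _ a)
    exact hJr.mono_exponent hΩ.volume_ne_top (by exact_mod_cast le_max_left _ _)
  · filter_upwards [hf, hae'] with x hx hx' b
    -- Tail averages of values and gradients tend to the same limit as the sequence, which
    -- identifies that limit with the entry of `J`.
    have h1 := tendsto_tailAverage hθτ (hx b)
    rw [tendsto_nhds_unique (hx' (b.map Sum.inl)) h1]
    exact hx b

end LimitJets


/-! ### The operator on jets, finiteness of the energy, and a priori bounds. -/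

section Energy

variable {n : ℕ} {Ω : Set (Euc n)}

/-- The second order part of the operator, evaluated on a jet. -/
noncomputable def jetPrincipal (A : Euc n → Matrix (Fin n) (Fin n) ℝ) (J : Jet n) (x : Euc n) : ℝ :=
  ∑ i, ∑ j, A x i j * J (some (.inr (i, j))) x

/-- The lower order part of the operator, evaluated on a jet. -/
noncomputable def jetLower (b : Euc n × ℝ × Euc n → ℝ) (J : Jet n) (x : Euc n) : ℝ :=
  b (x, J none x, WithLp.toLp 2 fun i => J (some (.inl i)) x)

theorem IsWeakJet.principalPart_ae_eq (hΩ : IsOpen Ω) {J : Jet n} (hJ : IsWeakJet Ω J)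
    (A : Euc n → Matrix (Fin n) (Fin n) ℝ) :
    principalPart Ω A (J none) =ᵐ[volume.restrict Ω] jetPrincipal A J := by
  filter_upwards [ae_all_iff.2 fun a => hJ.weakJet_ae_eq hΩ a] with x hx
  refine Finset.sum_congr rfl fun i _ => Finset.sum_congr rfl fun j _ => ?_
  rw [← hx]
  rfl

theorem IsWeakJet.semilinearOp_ae_eq (hΩ : IsOpen Ω) {J : Jet n} (hJ : IsWeakJet Ω J)
    (A : Euc n → Matrix (Fin n) (Fin n) ℝ) (b : Euc n × ℝ × Euc n → ℝ) :
    semilinearOp Ω A b (J none)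
      =ᵐ[volume.restrict Ω] fun x => jetPrincipal A J x + jetLower b J x := by
  filter_upwards [hJ.principalPart_ae_eq hΩ A, ae_all_iff.2 fun a => hJ.weakJet_ae_eq hΩ a]
    with x hx hx'
  have h1 : weakGrad Ω (J none) x = WithLp.toLp 2 fun i => J (some (.inl i)) x := by
    simp only [← hx']
    rfl
  rw [semilinearOp, hx, jetLower, h1]

theorem jetPrincipal_add (A : Euc n → Matrix (Fin n) (Fin n) ℝ) (J K : Jet n) (x : Euc n) :
    jetPrincipal A (J + K) x = jetPrincipal A J x + jetPrincipal A K x := by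
  simp only [jetPrincipal, Pi.add_apply, mul_add, Finset.sum_add_distrib]

theorem sum_mul_jetPrincipal (A : Euc n → Matrix (Fin n) (Fin n) ℝ) (s : Finset ℕ) (θ : ℕ → ℝ)
    (J : ℕ → Jet n) (x : Euc n) :
    ∑ k ∈ s, θ k * jetPrincipal A (J k) x
      = ∑ i, ∑ j, A x i j * ∑ k ∈ s, θ k * J k (some (.inr (i, j))) x := by
  simp only [jetPrincipal, Finset.mul_sum]
  rw [Finset.sum_comm]
  refine Finset.sum_congr rfl fun i _ => ?_
  rw [Finset.sum_comm]
  exact Finset.sum_congr rfl fun j _ => Finset.sum_congr rfl fun k _ => by ring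

theorem aestronglyMeasurable_jetPrincipal (hΩ : IsOpen Ω) {A : Euc n → Matrix (Fin n) (Fin n) ℝ}
    (hA : ∀ i j, ContDiffOn ℝ 2 (fun x => A x i j) (closure Ω)) {J : Jet n}
    (hJ : ∀ a, AEStronglyMeasurable (J a) (volume.restrict Ω)) :
    AEStronglyMeasurable (jetPrincipal A J) (volume.restrict Ω) := by
  have h : jetPrincipal A J = ∑ i, ∑ j, fun x => A x i j * J (some (.inr (i, j))) x := by
    funext x
    simp [jetPrincipal, Finset.sum_apply]
  rw [h]
  exact Finset.aestronglyMeasurable_sum _ fun i _ => Finset.aestronglyMeasurable_sum _ fun j _ =>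
    ((((hA i j).continuousOn).mono subset_closure).aestronglyMeasurable hΩ.measurableSet).mul
      (hJ _)

/-- The lower order term of a function in `W^{2,p}`, `p > n`, is essentially bounded. -/
theorem exists_ae_norm_jetLower_le (hΩ : IsBoundedLipschitzDomain Ω)
    {b : Euc n × ℝ × Euc n → ℝ} (hb : ContinuousOn b (closure Ω ×ˢ univ)) {p : ℝ≥0} (hp : 1 ≤ p)
    (hnp : (n : ℝ≥0) < p) {J : Jet n} (hJ : IsWeakJet Ω J)
    (hJp : ∀ a, MemLp (J a) p (volume.restrict Ω)) :
    ∃ C : ℝ, ∀ᵐ x ∂(volume.restrict Ω), ‖jetLower b J x‖ ≤ C := by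
  obtain ⟨C₀, hC₀⟩ := exists_ae_norm_le hΩ hp hnp (u := J none)
    (g := fun i => J (some (.inl i))) hJ.1 (hJp _) fun _ => hJp _
  have h1 : ∀ i, ∃ C : ℝ, ∀ᵐ x ∂(volume.restrict Ω), ‖J (some (.inl i)) x‖ ≤ C := fun i =>
    exists_ae_norm_le hΩ hp hnp (u := J (some (.inl i)))
      (g := fun j => J (some (.inr (i, j)))) (hJ.2 i) (hJp _) fun _ => hJp _
  choose C₁ hC₁ using h1
  -- Morrey's embedding, applied to the function and to its first derivatives, confines the
  -- arguments of `b` to this compact set.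
  set K : Set (Euc n × ℝ × Euc n) := closure Ω ×ˢ (Metric.closedBall (0 : ℝ) C₀ ×ˢ
    ((WithLp.toLp 2) '' Set.pi univ fun i => Metric.closedBall (0 : ℝ) (C₁ i))) with hK
  have hKc : IsCompact K := by
    refine hΩ.isCompact_closure.prod ((isCompact_closedBall _ _).prod (IsCompact.image ?_ ?_))
    · exact isCompact_univ_pi fun i => isCompact_closedBall _ _
    · exact PiLp.continuous_toLp 2 _
  obtain ⟨C, hC⟩ := hKc.exists_bound_of_continuousOn
    (hb.mono (prod_mono_right (subset_univ _)))
  refine ⟨C, ?_⟩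
  filter_upwards [ae_restrict_mem hΩ.isOpen.measurableSet, hC₀, ae_all_iff.2 hC₁]
    with x hx h2 h3
  refine hC _ ⟨subset_closure hx, ?_, _, ?_, rfl⟩
  · rwa [mem_closedBall_zero_iff]
  · intro i _
    rw [mem_closedBall_zero_iff]
    exact h3 i

theorem exists_ae_norm_le_of_memLp_top {X : Type*} [MeasurableSpace X] {μ : Measure X}
    {f : X → ℝ} (hf : MemLp f ⊤ μ) : ∃ C : ℝ, ∀ᵐ x ∂μ, ‖f x‖ ≤ C := by
  have h := hf.2
  rw [eLpNorm_exponent_top] at h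
  refine ⟨(eLpNormEssSup f μ).toReal, ?_⟩
  filter_upwards [ae_le_eLpNormEssSup (f := f) (μ := μ)] with x hx
  have := ENNReal.toReal_mono h.ne hx
  rwa [toReal_enorm] at this

theorem EInfty_le_of_ae_le {A : Euc n → Matrix (Fin n) (Fin n) ℝ} {b : Euc n × ℝ × Euc n → ℝ}
    {u : Euc n → ℝ} {C : ℝ≥0∞}
    (h : ∀ᵐ x ∂(volume.restrict Ω), ‖semilinearOp Ω A b u x‖ₑ ≤ C) : EInfty Ω A b u ≤ C :=
  essSup_le_of_ae_le C h

theorem ae_le_EInfty (A : Euc n → Matrix (Fin n) (Fin n) ℝ) (b : Euc n × ℝ × Euc n → ℝ)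
    (u : Euc n → ℝ) :
    ∀ᵐ x ∂(volume.restrict Ω), ‖semilinearOp Ω A b u x‖ₑ ≤ EInfty Ω A b u :=
  ae_le_essSup

/-- The principal part is bounded by definition of the class and the lower order part by Morrey's
embedding, with exponent `n + 2 > n`. Applied to `u₀`, it makes the infimum finite. -/
theorem MemCalW.EInfty_lt_top (hΩ : IsBoundedLipschitzDomain Ω)
    {A : Euc n → Matrix (Fin n) (Fin n) ℝ} {b : Euc n × ℝ × Euc n → ℝ}
    (hb : ContinuousOn b (closure Ω ×ˢ univ)) {u : Euc n → ℝ} (hu : MemCalW Ω A u) :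
    EInfty Ω A b u < ⊤ := by
  have hq : (1 : ℝ≥0) < n + 2 := lt_of_lt_of_le (by norm_num) (le_add_self)
  have hu2 := hu.1 _ hq
  have hJ := hu2.isWeakJet hΩ.isOpen
  obtain ⟨C₁, hC₁⟩ := exists_ae_norm_jetLower_le hΩ hb hq.le (by simp) hJ
    fun a => hu2.memLp hΩ.isOpen hJ rfl a
  obtain ⟨C₂, hC₂⟩ := exists_ae_norm_le_of_memLp_top hu.2
  refine (EInfty_le_of_ae_le (C := ENNReal.ofReal (C₂ + C₁)) ?_).trans_lt ENNReal.ofReal_lt_top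
  filter_upwards [hC₁, hC₂] with x h1 h2
  rw [← ofReal_norm]
  exact ENNReal.ofReal_le_ofReal ((norm_add_le _ _).trans (add_le_add h2 h1))

theorem memCalWZero_zero (hΩ : IsOpen Ω) (A : Euc n → Matrix (Fin n) (Fin n) ℝ) :
    MemCalWZero Ω A 0 := by
  have h0 := isWeakJet_zero (n := n) (Ω := Ω)
  have hW : ∀ q : ℝ≥0∞, MemW2 Ω q (0 : Euc n → ℝ) := fun q => h0.memW2 fun a => MemLp.zero
  refine ⟨⟨fun q _ => hW q, ?_⟩, hW 2, fun ε hε => ⟨0, isTestFunction_zero, ?_⟩⟩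
  · refine (memLp_congr_ae (h0.principalPart_ae_eq hΩ A)).2 ?_
    have : jetPrincipal A (0 : Jet n) = 0 := by
      funext x
      simp [jetPrincipal]
    rw [this]
    exact MemLp.zero
  · have h1 := h0.normW2_eq hΩ 2
    rw [sub_zero]
    refine lt_of_le_of_lt (le_of_eq ?_) hε
    refine h1.trans ?_
    simp [jetNorm]

/-- Admissibility bounds the `W^{2,p}` norms along a sequence of bounded energy. -/
theorem IsAdmissible.exists_bound (hΩ : IsBoundedLipschitzDomain Ω)
    {A : Euc n → Matrix (Fin n) (Fin n) ℝ} {b : Euc n × ℝ × Euc n → ℝ}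
    (hS : IsAdmissible Ω A b) {u₀ : Euc n → ℝ} (hu₀ : MemCalW Ω A u₀) {v : ℕ → Euc n → ℝ}
    (hv : ∀ k, MemCalWZero Ω A (v k - u₀)) {E : ℝ≥0} (hE : ∀ k, EInfty Ω A b (v k) ≤ E) :
    ∃ p₀ : ℝ≥0, ∀ p : ℝ≥0, p₀ ≤ p → ∃ M : ℝ≥0, ∀ k a,
      eLpNorm (weakJet Ω (v k - u₀) a) p (volume.restrict Ω) ≤ M := by
  have : IsFiniteMeasure (volume.restrict Ω) := ⟨by simpa using hΩ.volume_ne_top.lt_top⟩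
  obtain ⟨p₀, hp₀, h⟩ := hS
  refine ⟨p₀, fun p hp => ?_⟩
  have hp1 : 1 < p := hp₀.trans_le hp
  have hp1' : (1 : ℝ≥0∞) ≤ p := by exact_mod_cast hp1.le
  set c : ℝ≥0∞ := (E : ℝ≥0∞) * (volume.restrict Ω) univ ^ (p : ℝ≥0∞).toReal⁻¹ with hc
  have hct : c ≠ ⊤ := ENNReal.mul_ne_top ENNReal.coe_ne_top
    (ENNReal.rpow_ne_top_of_nonneg (by positivity) (measure_ne_top _ _))
  -- The number `c` bounds the `L^p` norm of `S` on a set of finite measure; adding one makes the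
  -- level positive.
  obtain ⟨C, -, hC⟩ := h p hp u₀ hu₀ (c.toNNReal + 1) (by positivity)
  have hu₀p := hu₀.1 p hp1
  have hJ₀ := hu₀p.isWeakJet hΩ.isOpen
  have hN₀ : jetNorm Ω p (weakJet Ω u₀) ≠ ⊤ :=
    ENNReal.sum_ne_top.2 fun a _ => (hu₀p.memLp hΩ.isOpen hJ₀ rfl a).2.ne
  refine ⟨C + (jetNorm Ω p (weakJet Ω u₀)).toNNReal, fun k a => ?_⟩
  have hwp := (hv k).1.1 p hp1
  -- Admissibility concerns `W_0^{2,p}`, so the condition in `W_0^{2,2}` has to be raised to the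
  -- exponent `p`.
  have hw0 : MemW2Zero Ω p (v k - u₀) := (hv k).2.of_memW2 hΩ hp1.le (by norm_num) hwp
  have hS' : eLpNorm (semilinearOp Ω A b (v k)) p (volume.restrict Ω)
      ≤ ((c.toNNReal + 1 : ℝ≥0) : ℝ≥0∞) := by
    have h1 : ∀ᵐ x ∂(volume.restrict Ω), ‖semilinearOp Ω A b (v k) x‖ₑ ≤ (E : ℝ≥0∞) := by
      filter_upwards [ae_le_EInfty A b (v k)] with x hx using hx.trans (hE k)
    refine (eLpNorm_le_of_ae_enorm_bound h1).trans ?_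
    rw [smul_eq_mul, ENNReal.coe_add, ENNReal.coe_toNNReal hct]
    exact le_self_add
  have hnorm := hC (v k) hw0 hS'
  have hwJ := hwp.isWeakJet hΩ.isOpen
  have hsum := hwJ.add hJ₀
  have hnone : (weakJet Ω (v k - u₀) + weakJet Ω u₀) none = v k := sub_add_cancel (v k) u₀
  rw [← hnone, hsum.normW2_eq hΩ.isOpen] at hnorm
  have hm := (hwp.memLp hΩ.isOpen hwJ rfl a).1
  have hm₀ := (hu₀p.memLp hΩ.isOpen hJ₀ rfl a).1
  have h2 : eLpNorm ((weakJet Ω (v k - u₀) + weakJet Ω u₀) a) p (volume.restrict Ω) ≤ C :=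
    (eLpNorm_le_jetNorm (p : ℝ≥0∞) (weakJet Ω (v k - u₀) + weakJet Ω u₀) a).trans hnorm
  have h3 : eLpNorm (weakJet Ω u₀ a) p (volume.restrict Ω) ≤ jetNorm Ω p (weakJet Ω u₀) :=
    eLpNorm_le_jetNorm (p : ℝ≥0∞) (weakJet Ω u₀) a
  have h4 := eLpNorm_sub_le (hm.add hm₀) hm₀ hp1'
  rw [add_sub_cancel_right] at h4
  rw [ENNReal.coe_add, ENNReal.coe_toNNReal hN₀]
  exact h4.trans (add_le_add h2 h3)

end Energy

/-! ### Existence of a minimizer. -/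

section Existence

variable {n : ℕ} {Ω : Set (Euc n)}

/-- The base point `x` is fixed in the closure of `Ω`, so continuity of `b` relative to that closed
set is enough. -/
theorem tendsto_jetLower {b : Euc n × ℝ × Euc n → ℝ}
    (hb : ContinuousOn b (closure Ω ×ˢ univ)) {J : ℕ → Jet n} {K : Jet n} {x : Euc n}
    (hx : x ∈ closure Ω) (h : ∀ o : Option (Fin n),
      Filter.Tendsto (fun k => J k (o.map Sum.inl) x) Filter.atTop (nhds (K (o.map Sum.inl) x))) :
    Filter.Tendsto (fun k => jetLower b (J k) x) Filter.atTop (nhds (jetLower b K x)) := by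
  have hcont := hb (x, K none x, WithLp.toLp 2 fun i => K (some (.inl i)) x) ⟨hx, mem_univ _⟩
  refine Filter.Tendsto.comp hcont (tendsto_nhdsWithin_iff.2 ⟨?_, ?_⟩)
  · refine tendsto_const_nhds.prodMk_nhds ((h none).prodMk_nhds ?_)
    refine ((PiLp.continuous_toLp 2 _).tendsto _).comp ?_
    exact tendsto_pi_nhds.2 fun i => h (some i)
  · exact Filter.Eventually.of_forall fun k => ⟨hx, mem_univ _⟩

/-- Existence of minimizers of the supremal functional. -/
theorem exists_minimizer (hΩ : IsBoundedLipschitzDomain Ω)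
    {A : Euc n → Matrix (Fin n) (Fin n) ℝ}
    (hA : ∀ i j, ContDiffOn ℝ 2 (fun x => A x i j) (closure Ω))
    {b : Euc n × ℝ × Euc n → ℝ} (hb : ContinuousOn b (closure Ω ×ˢ univ))
    (hS : IsAdmissible Ω A b) {u₀ : Euc n → ℝ} (hu₀ : MemCalW Ω A u₀) :
    ∃ u, MemCalWZero Ω A (u - u₀) ∧ EInfty Ω A b u < ⊤ ∧
      ∀ v, MemCalWZero Ω A (v - u₀) → EInfty Ω A b u ≤ EInfty Ω A b v := by
  have hopen := hΩ.isOpen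
  set m : ℝ≥0∞ := ⨅ v : {v : Euc n → ℝ // MemCalWZero Ω A (v - u₀)}, EInfty Ω A b v with hm
  have hmle : ∀ v, MemCalWZero Ω A (v - u₀) → m ≤ EInfty Ω A b v := fun v hv =>
    iInf_le (fun v : {v : Euc n → ℝ // MemCalWZero Ω A (v - u₀)} => EInfty Ω A b v) ⟨v, hv⟩
  have hmt : m < ⊤ := (hmle u₀ (by rw [sub_self]; exact memCalWZero_zero hopen A)).trans_lt
    (hu₀.EInfty_lt_top hΩ hb)
  have hseq : ∀ k : ℕ, ∃ v, MemCalWZero Ω A (v - u₀) ∧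
      EInfty Ω A b v < m + ENNReal.ofReal (1 / ((k : ℝ) + 1)) := by
    intro k
    have hlt : m < m + ENNReal.ofReal (1 / ((k : ℝ) + 1)) :=
      ENNReal.lt_add_right hmt.ne (ENNReal.ofReal_pos.2 (by positivity)).ne'
    obtain ⟨⟨v, hv⟩, hvlt⟩ := iInf_lt_iff.1 hlt
    exact ⟨v, hv, hvlt⟩
  choose v hv hvlt using hseq
  have hbound := hS.exists_bound hΩ hu₀ hv (E := m.toNNReal + 1) fun k => by
    refine (hvlt k).le.trans ?_
    rw [ENNReal.coe_add, ENNReal.coe_toNNReal hmt.ne, ENNReal.coe_one]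
    gcongr
    rw [ENNReal.ofReal_le_one, div_le_one (by positivity)]
    linarith [k.cast_nonneg (α := ℝ)]
  obtain ⟨p₀, hp₀⟩ := hbound
  obtain ⟨J, σ, θ, hσ, hθ, hJ, hJ0, hJq, hgrad, htail⟩ :=
    exists_limit_jet hΩ (fun k => (hv k).2) (fun k => (hv k).1.1) hp₀
  have hq : (1 : ℝ≥0) < n + 2 := lt_of_lt_of_le (by norm_num) (le_add_self)
  have hu₀2 := hu₀.1 _ hq
  have hU := hu₀2.isWeakJet hopen
  set U := weakJet Ω u₀ with hUdef
  have hL := hU.add hJ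
  have hLp : ∀ a, MemLp ((U + J) a) (n + 2 : ℝ≥0) (volume.restrict Ω) := fun a =>
    (hu₀2.memLp hopen hU rfl a).add ((hJq _ hq).memLp hopen hJ rfl a)
  have hLn : (U + J) none = u₀ + J none := rfl
  have hSu := hL.semilinearOp_ae_eq hopen A b
  rw [hLn] at hSu
  have hwJ : ∀ k, IsWeakJet Ω (weakJet Ω (v k - u₀)) := fun k => (hv k).2.1.isWeakJet hopen
  have hSv : ∀ k, ∀ᵐ x ∂(volume.restrict Ω),
      ‖jetPrincipal A (U + weakJet Ω (v k - u₀)) x + jetLower b (U + weakJet Ω (v k - u₀)) x‖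
        ≤ m.toReal + 1 / ((k : ℝ) + 1) := by
    intro k
    have h1 := (hU.add (hwJ k)).semilinearOp_ae_eq hopen A b
    rw [show (U + weakJet Ω (v k - u₀)) none = v k from add_sub_cancel u₀ (v k)] at h1
    filter_upwards [h1, ae_le_EInfty A b (v k)] with x h2 h3
    rw [← h2]
    have h4 := ENNReal.toReal_mono (ENNReal.add_ne_top.2 ⟨hmt.ne, ENNReal.ofReal_ne_top⟩)
      (h3.trans (hvlt k).le)
    rwa [toReal_enorm, ENNReal.toReal_add hmt.ne ENNReal.ofReal_ne_top,
      ENNReal.toReal_ofReal (by positivity)] at h4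
  have hfinal : ∀ᵐ x ∂(volume.restrict Ω), ‖semilinearOp Ω A b (u₀ + J none) x‖ ≤ m.toReal := by
    filter_upwards [hSu, ae_all_iff.2 hSv, hgrad, htail, ae_restrict_mem hopen.measurableSet]
      with x h1 h2 h3 h4 hx
    rw [h1]
    have hlow : Filter.Tendsto (fun k => jetLower b (U + weakJet Ω (v (σ k) - u₀)) x)
        Filter.atTop (nhds (jetLower b (U + J) x)) :=
      tendsto_jetLower hb (subset_closure hx) fun o => (h3 o).const_add _
    have hprin : Filter.Tendsto (fun k => ∑ j ∈ (θ k).support,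
        θ k j * jetPrincipal A (weakJet Ω (v (σ j) - u₀)) x) Filter.atTop
        (nhds (jetPrincipal A J x)) := by
      simp only [sum_mul_jetPrincipal]
      exact tendsto_finsetSum _ fun i _ => tendsto_finsetSum _ fun j _ => (h4 _).const_mul _
    have hsum := (hprin.const_add (jetPrincipal A U x)).add (tendsto_tailAverage hθ hlow)
    rw [← jetPrincipal_add] at hsum
    have hzero : Filter.Tendsto (fun k : ℕ => m.toReal + 1 / ((k : ℝ) + 1)) Filter.atTop
        (nhds m.toReal) := by
      simpa using tendsto_one_div_add_atTop_nhds_zero_nat.const_add m.toReal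
    -- The inequality is passed to the limit along tail averages of `S(v (σ j))`: by linearity the
    -- principal part of the average is the average of the principal parts.
    refine le_of_tendsto_of_tendsto hsum.norm hzero (Filter.Eventually.of_forall fun k => ?_)
    have heq : jetPrincipal A U x + ∑ j ∈ (θ k).support,
          θ k j * jetPrincipal A (weakJet Ω (v (σ j) - u₀)) x
        + ∑ j ∈ (θ k).support, θ k j * jetLower b (U + weakJet Ω (v (σ j) - u₀)) x
        = ∑ j ∈ (θ k).support, θ k j * (jetPrincipal A (U + weakJet Ω (v (σ j) - u₀)) x
          + jetLower b (U + weakJet Ω (v (σ j) - u₀)) x) := by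
      simp only [jetPrincipal_add, mul_add, Finset.sum_add_distrib]
      rw [← Finset.sum_mul, (hθ k).3, one_mul]
    simp only [heq]
    refine (hθ k).norm_sum_le fun j hj => (h2 (σ j)).trans ?_
    -- From `k ≤ j ≤ σ j`, each term of the average satisfies the bound at level `k`.
    have h5 : (k : ℝ) ≤ σ j := by exact_mod_cast hj.trans (hσ.le_apply)
    gcongr
  refine ⟨u₀ + J none, ?_, ?_, ?_⟩
  · rw [add_sub_cancel_left]
    refine ⟨⟨hJq, (memLp_congr_ae (hJ.principalPart_ae_eq hopen A)).2 ?_⟩, hJ0⟩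
    obtain ⟨C₁, hC₁⟩ := exists_ae_norm_jetLower_le hΩ hb hq.le (by simp) hL hLp
    obtain ⟨C₂, hC₂⟩ := exists_ae_norm_le_of_memLp_top hu₀.2
    refine memLp_top_of_bound (aestronglyMeasurable_jetPrincipal hopen hA fun a =>
      ((hJq _ hq).memLp hopen hJ rfl a).1) (m.toReal + C₁ + C₂) ?_
    filter_upwards [hC₁, hC₂, hU.principalPart_ae_eq hopen A, hfinal, hSu] with x h1 h2 h3 h4 h5
    have h3' : principalPart Ω A u₀ x = jetPrincipal A U x := h3
    -- The equation is solved for the principal part of `u - u₀`; the three terms on the right are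
    -- bounded by `m`, by Morrey's embedding and by the assumption on `u₀`.
    have h6 : jetPrincipal A J x = semilinearOp Ω A b (u₀ + J none) x - jetLower b (U + J) x
        - principalPart Ω A u₀ x := by
      rw [h5, h3', jetPrincipal_add]
      ring
    rw [h6]
    exact (norm_sub_le _ _).trans (add_le_add ((norm_sub_le _ _).trans (add_le_add h4 h1)) h2)
  all_goals
    have hE : EInfty Ω A b (u₀ + J none) ≤ m := by
      refine EInfty_le_of_ae_le ?_
      filter_upwards [hfinal] with x hx
      rw [← ofReal_norm, ← ENNReal.ofReal_toReal hmt.ne]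
      exact ENNReal.ofReal_le_ofReal hx
  · exact hE.trans_lt hmt
  · exact fun v hv => hE.trans (hmle v hv)

end Existence

end SupremalSobolev

theorem proposition1 {n : ℕ} (hn : 0 < n)
    (Ω : Set (EuclideanSpace ℝ (Fin n)))
    (hΩ : SupremalSobolev.IsBoundedLipschitzDomain Ω)
    (A : EuclideanSpace ℝ (Fin n) → Matrix (Fin n) (Fin n) ℝ)
    (hA : ∀ i j, ContDiffOn ℝ 2 (fun x => A x i j) (closure Ω))
    (b : EuclideanSpace ℝ (Fin n) × ℝ × EuclideanSpace ℝ (Fin n) → ℝ)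
    (hb : ContDiffOn ℝ 2 b (closure Ω ×ˢ Set.univ))
    (hell : ∃ lam : ℝ, 0 < lam ∧ ∀ x ∈ Ω, (A x).IsSymm ∧
      ∀ ζ : EuclideanSpace ℝ (Fin n), lam * ‖ζ‖ ^ 2 ≤ ∑ i, ∑ j, A x i j * (ζ i * ζ j))
    (hS : SupremalSobolev.IsAdmissible Ω A b)
    (u₀ : EuclideanSpace ℝ (Fin n) → ℝ) (hu₀ : SupremalSobolev.MemCalW Ω A u₀) :
    ∃ u, SupremalSobolev.MemCalWZero Ω A (u - u₀) ∧
      SupremalSobolev.EInfty Ω A b u < ⊤ ∧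
      ∀ v, SupremalSobolev.MemCalWZero Ω A (v - u₀) →
        SupremalSobolev.EInfty Ω A b u ≤ SupremalSobolev.EInfty Ω A b v :=
  SupremalSobolev.exists_minimizer hΩ hA hb.continuousOn hS hu₀
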